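/- Let $\mathcal{X}$ be a homogeneous tree of degree $q+1$, $q\ge 2$ (a connected graph without cycles in which every vertex has $q+1$ neighbours), with graph distance $d$ and a fixed vertex $o$; write $|x|=d(o,x)$. Let $\Omega$ be the set of infinite geodesic rays $\omega=\{\omega_0,\omega_1,\dots\}$ starting at $o$. For $x\in\mathcal X$ and $\omega\in\Omega$ let $c(x,\omega)$ be the last vertex of the geodesic from $o$ to $x$ that lies on $\omega$, and put $E(x)=\{\omega:|c(x,\omega)|\ge|x|\}$, the set of rays passing through $x$. Equip $\Omega$ with the $\sigma$-algebra generated by the sets $E(x)$ and with the probability measure $\nu$ such that $\nu(E(x))=\frac{1}{(q+1)q^{|x|-1}}$ for $x\ne o$ and $\nu(E(o))=1$. Put $$p(x,\omega)=q^{2|c(x,\omega)|-|x|},\qquad \mathcal P_zF(x)=\int_\Omega p(x,\omega)^{1/2+iz}F(\omega)\,d\nu(\omega),\qquad \mathcal P_z\mu(x)=\int_\Omega p(x,\omega)^{1/2+iz}\,d\mu(\omega)$$ for $z\in\mathbb C$, $F\in L^1(\Omega)$ and complex measures $\mu$ on $\Omega$; let $\phi_z=\mathcal P_z\mathbf 1$,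 which depends only on $|x|$, so that one may write $\phi_z(n)$ for its value at $|x|=n$. Let $$\mathcal Lu(x)=u(x)-\frac1{q+1}\sum_{d(x,y)=1}u(y),\qquad \gamma(z)=1-\frac{q^{1/2+iz}+q^{1/2-iz}}{q+1},\qquad \tau=\frac{2\pi}{\log q}.$$ For $1\le p\le 2$ let $p'$ be the conjugate exponent and $\delta_p=-\delta_{p'}=\frac1p-\frac12$. For $u:\mathcal X\to\mathbb C$ put $$\|u\|_{\mathcal H^r_p(\mathcal X)}=\sup_{n\ge0}\ \phi_{i\delta_p}(n)^{-1}\Big(\frac1{\#\{y:|y|=n\}}\sum_{|y|=n}|u(y)|^r\Big)^{1/r}\ (1\le r<\infty),\qquad \|u\|_{\mathcal H^\infty_p(\mathcal X)}=\sup_{x\in\mathcal X}\phi_{i\delta_p}(x)^{-1}|u(x)|,$$ and let $\mathcal H^r_p(\mathcal X)$ be the set of all $u$ for which this is finite. **Theorem.** Let $1\le p\le2$ and $z=\alpha+i\delta_{p'}$, where $\alpha\in\mathbb R$ if $p<2$, and $\alpha\in(\tau/2)\mathbb Z$ if $p=2$. Let $u$ be a complex-valued function on $\mathcal X$. 1.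 If $1<r\le\infty$, then $u=\mathcal P_zF$ for some $F\in L^r(\Omega)$ if and only if $u\in\mathcal H^r_p(\mathcal X)$ and $\mathcal Lu=\gamma(z)u$. 2. $u=\mathcal P_z\mu$ for some complex measure $\mu$ on $\Omega$ if and only if $u\in\mathcal H^1_p(\mathcal X)$ and $\mathcal Lu=\gamma(z)u$. 3. There is a constant $C_p>0$ depending only on $p$ (not on $q$, $\alpha$, $r$ or $F$) such that for all $1\le r\le\infty$ and all $F\in L^r(\Omega)$ $$C_p\|F\|_{L^r(\Omega)}\le\|\mathcal P_zF\|_{\mathcal H^r_p(\mathcal X)}\le\|F\|_{L^r(\Omega)}.$$ -/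

import Mathlib

open MeasureTheory
open scoped ENNReal

universe u

noncomputable section

namespace HomTree

variable {V : Type u}

/-- `G` is a homogeneous tree of degree `q + 1`, where `q ≥ 2`: a connected graph without cycles in
which every vertex has exactly `q + 1` neighbours. -/
structure IsHomogeneousTree (G : SimpleGraph V) [G.LocallyFinite] (q : ℕ) : Prop where
  two_le : 2 ≤ q
  isTree : G.IsTree
  regular : G.IsRegularOfDegree (q + 1)

/-- The boundary `Ω`: the infinite geodesic rays `{ω 0, ω 1, …}` issuing from `o`. (A chain of
consecutively adjacent vertices issuing from `o` is geodesic iff `d(o, ω n) = n` for all `n`.) -/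
@[ext]
structure Boundary (G : SimpleGraph V) (o : V) where
  toFun : ℕ → V
  map_zero' : toFun 0 = o
  adj' : ∀ n, G.Adj (toFun n) (toFun (n + 1))
  dist' : ∀ n, G.dist o (toFun n) = n

instance (G : SimpleGraph V) (o : V) : CoeFun (Boundary G o) (fun _ => ℕ → V) := ⟨Boundary.toFun⟩

section Boundary

variable (G : SimpleGraph V) (o : V)

open Classical in
/-- `c(x, ω)`: the last vertex of the geodesic path from `o` to `x` that lies on `ω`. A vertex `y`
lies on the geodesic path from `o` to `x` iff `d(o, y) + d(y, x) = d(o, x)`; the vertex of that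
path at distance `j` from `o` lies on `ω` iff it is `ω j`. -/
def confluent (x : V) (ω : Boundary G o) : V :=
  ω (Nat.findGreatest (fun j => G.dist o (ω j) + G.dist (ω j) x = G.dist o x) (G.dist o x))

/-- The sectors `E_j(x) = {ω : |c(x, ω)| ≥ j}`. -/
def sectorGE (j : ℕ) (x : V) : Set (Boundary G o) :=
  {ω | j ≤ G.dist o (confluent G o x ω)}

/-- `E(x) = E_{|x|}(x)`. -/
def sector (x : V) : Set (Boundary G o) :=
  sectorGE G o (G.dist o x) x

/-- The `σ`-algebra on `Ω` generated by the sets `E(x)`. -/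
instance Boundary.instMeasurableSpace : MeasurableSpace (Boundary G o) :=
  MeasurableSpace.generateFrom (Set.range (sector G o))

/-- The neighbours of `x` that are farther from `o` than `x`. -/
def Children (x : V) : Type u :=
  {y : V // G.Adj x y ∧ G.dist o y = G.dist o x + 1}

instance (x : V) : MeasurableSpace (Children G o x) := ⊤

instance (x : V) : MeasurableSingletonClass (Children G o x) := ⟨fun _ => trivial⟩

instance [G.LocallyFinite] (x : V) : Finite (Children G o x) :=
  Finite.of_injective (fun y => (⟨y.1, y.2.1⟩ : G.neighborSet x)) fun _ _ h =>
    Subtype.ext (congrArg (fun z : G.neighborSet x => (z : V)) h)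

/-- The vertices reached from `o` when one always moves from `x` to its child `s x`. -/
def rayFun (s : ∀ x, Children G o x) : ℕ → V
  | 0 => o
  | n + 1 => (s (rayFun s n)).1

lemma dist_rayFun (s : ∀ x, Children G o x) (n : ℕ) : G.dist o (rayFun G o s n) = n := by
  induction n with
  | zero => simp [rayFun]
  | succ n ih => rw [rayFun, (s (rayFun G o s n)).2.2, ih]

/-- The geodesic ray obtained by always moving from `x` to its child `s x`. -/
def ray (s : ∀ x, Children G o x) : Boundary G o where
  toFun := rayFun G o s
  map_zero' := rfl
  adj' := fun n => (s (rayFun G o s n)).2.1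
  dist' := dist_rayFun G o s

/-- The probability measure `ν` on `Ω`: the law of the geodesic ray obtained by choosing, at each
vertex independently, a child uniformly at random. By `boundaryMeasure_sector` below it is the
measure with `ν(E(o)) = 1` and `ν(E(x)) = 1 / ((q + 1) q ^ (|x| - 1))` for `x ≠ o`. -/
def boundaryMeasure : Measure (Boundary G o) :=
  (Measure.infinitePi fun x : V =>
    ProbabilityTheory.uniformOn (Set.univ : Set (Children G o x))).map (ray G o)

end Boundary

/-- The number of vertices at distance `n` from a given vertex. -/
def sphereCard (q n : ℕ) : ℕ := if n = 0 then 1 else (q + 1) * q ^ (n - 1)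

section Facts

variable {G : SimpleGraph V} {o : V}

lemma mem_sector (hG : G.Connected) {x : V} {ω : Boundary G o} :
    ω ∈ sector G o x ↔ ω (G.dist o x) = x := by
  classical
  simp only [sector, sectorGE, Set.mem_ofPred_eq, confluent, ω.dist']
  set P : ℕ → Prop := fun j => j + G.dist (ω j) x = G.dist o x with hP
  constructor
  · intro h
    have h1 : Nat.findGreatest P (G.dist o x) = G.dist o x :=
      le_antisymm (Nat.findGreatest_le _) (by convert h)
    have h0 : P 0 := by simp [hP, ω.map_zero']
    have h2 : P (G.dist o x) := by
      have := Nat.findGreatest_spec (P := P) (Nat.zero_le (G.dist o x)) h0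
      rwa [h1] at this
    simp only [hP] at h2
    exact hG.dist_eq_zero_iff.1 (by omega)
  · intro h
    have h2 : P (G.dist o x) := by simp [hP, h]
    have := Nat.le_findGreatest (P := P) le_rfl h2
    convert this

/-- A vertex of a tree has at most one neighbour that is closer to `o`. -/
lemma parent_unique (hG : G.IsTree) {x y z : V} (hx : G.Adj x z) (hy : G.Adj y z)
    (hxz : G.dist o z = G.dist o x + 1) (hyz : G.dist o z = G.dist o y + 1) : x = y := by
  have key : ∀ w : V, G.Adj w z → G.dist o z = G.dist o w + 1 →
      ∃ p : G.Walk o z, p.IsPath ∧ p.penultimate = w := by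
    intro w hw hd
    obtain ⟨p, hp⟩ := hG.connected.exists_walk_length_eq_dist o w
    refine ⟨p.concat hw, ?_, by simp⟩
    apply SimpleGraph.Walk.isPath_of_length_eq_dist
    rw [SimpleGraph.Walk.length_concat, hp, hd]
  obtain ⟨p, hp, rfl⟩ := key x hx hxz
  obtain ⟨p', hp', rfl⟩ := key y hy hyz
  rw [(hG.existsUnique_path o z).unique hp hp']

lemma exists_parent (hG : G.IsTree) {z : V} {n : ℕ} (hz : G.dist o z = n + 1) :
    ∃ x, G.Adj x z ∧ G.dist o x = n := by
  obtain ⟨p, hp⟩ := hG.connected.exists_walk_length_eq_dist z o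
  rw [SimpleGraph.dist_comm, hz] at hp
  cases p with
  | nil => simp at hp
  | cons h p =>
    rename_i x
    refine ⟨x, h.symm, ?_⟩
    have h1 := SimpleGraph.dist_le p
    rw [SimpleGraph.dist_comm] at h1
    rw [SimpleGraph.Walk.length_cons] at hp
    have h2 := hG.dist_eq_dist_add_one_of_adj o h
    omega

lemma card_children_root [G.LocallyFinite] {q : ℕ} (hG : IsHomogeneousTree G q) :
    Nat.card (Children G o o) = q + 1 := by
  have h := Nat.subtype_card (p := fun y => G.Adj o y ∧ G.dist o y = G.dist o o + 1)
    (G.neighborFinset o) (fun y => by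
      rw [SimpleGraph.mem_neighborFinset, SimpleGraph.dist_self]
      exact ⟨fun h => ⟨h, by rw [zero_add, SimpleGraph.dist_eq_one_iff_adj]; exact h⟩,
        fun h => h.1⟩)
  exact h.trans (hG.regular o)

lemma card_children_of_ne [G.LocallyFinite] {q : ℕ} (hG : IsHomogeneousTree G q) {x : V}
    (hx : x ≠ o) : Nat.card (Children G o x) = q := by
  classical
  have hpos : G.dist o x ≠ 0 := fun h => hx (hG.isTree.connected.dist_eq_zero_iff.1 h).symm
  obtain ⟨n, hn⟩ := Nat.exists_eq_succ_of_ne_zero hpos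
  obtain ⟨w, hw, hwd⟩ := exists_parent hG.isTree hn
  have h := Nat.subtype_card (p := fun y => G.Adj x y ∧ G.dist o y = G.dist o x + 1)
    ((G.neighborFinset x).erase w) (fun y => by
      rw [Finset.mem_erase, SimpleGraph.mem_neighborFinset]
      constructor
      · rintro ⟨h1, h2⟩
        refine ⟨h2, ?_⟩
        rcases hG.isTree.dist_eq_dist_add_one_of_adj o h2 with h3 | h3
        · exact absurd (parent_unique hG.isTree h2.symm hw h3 (by omega)) h1
        · exact h3
      · rintro ⟨h1, h2⟩
        refine ⟨?_, h1⟩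
        rintro rfl
        omega)
  refine h.trans ?_
  rw [Finset.card_erase_of_mem (by simpa using hw.symm), SimpleGraph.card_neighborFinset_eq_degree,
    hG.regular x, Nat.add_sub_cancel]

lemma nonempty_children [G.LocallyFinite] {q : ℕ} (hG : IsHomogeneousTree G q) (x : V) :
    Nonempty (Children G o x) := by
  have h2 := hG.two_le
  refine (Nat.card_pos_iff.1 ?_).1
  by_cases hx : x = o
  · subst hx; rw [card_children_root hG]; omega
  · rw [card_children_of_ne hG hx]; omega

lemma uniformOn_child [G.LocallyFinite] (x : V) (y : Children G o x) :
    ProbabilityTheory.uniformOn (Set.univ : Set (Children G o x)) {y} =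
      (Nat.card (Children G o x) : ℝ≥0∞)⁻¹ := by
  have := Fintype.ofFinite (Children G o x)
  rw [ProbabilityTheory.uniformOn_univ, Measure.count_singleton, Nat.card_eq_fintype_card, one_div]

lemma sphereCard_succ [G.LocallyFinite] {q : ℕ} (hG : IsHomogeneousTree G q) (x : V) :
    sphereCard q (G.dist o x + 1) = Nat.card (Children G o x) * sphereCard q (G.dist o x) := by
  by_cases hx : x = o
  · subst hx; rw [card_children_root hG]; simp [sphereCard]
  · have hpos : G.dist o x ≠ 0 := fun h => hx (hG.isTree.connected.dist_eq_zero_iff.1 h).symm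
    obtain ⟨n, hn⟩ := Nat.exists_eq_succ_of_ne_zero hpos
    rw [card_children_of_ne hG hx, hn]
    simp [sphereCard, pow_succ]
    ring

/-- The event that the random ray passes through a given vertex is a finite cylinder. -/
lemma exists_cylinder [G.LocallyFinite] {q : ℕ} (hG : IsHomogeneousTree G q) (n : ℕ) :
    ∀ x : V, G.dist o x = n → ∃ (S : Finset V) (t : ∀ v, Set (Children G o v)),
      (∀ v ∈ S, G.dist o v < n) ∧
      (∀ s : ∀ v, Children G o v, rayFun G o s n = x ↔ s ∈ Set.pi (S : Set V) t) ∧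
      ∏ v ∈ S, ProbabilityTheory.uniformOn (Set.univ : Set (Children G o v)) (t v) =
        (sphereCard q n : ℝ≥0∞)⁻¹ := by
  classical
  induction n with
  | zero =>
    intro x hx
    have hx' : o = x := hG.isTree.connected.dist_eq_zero_iff.1 hx
    exact ⟨∅, fun _ => Set.univ, by simp, fun s => by simp [rayFun, hx'], by simp [sphereCard]⟩
  | succ n ih =>
    intro x hx
    obtain ⟨y, hy, hyn⟩ := exists_parent hG.isTree hx
    obtain ⟨S, t, hS, hst, hprod⟩ := ih y hyn
    have hyS : y ∉ S := fun h => by have := hS y h; omega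
    let c : Children G o y := ⟨x, hy, by omega⟩
    refine ⟨insert y S, Function.update t y {c}, ?_, ?_, ?_⟩
    · intro v hv
      rcases Finset.mem_insert.1 hv with rfl | hv
      · omega
      · have := hS v hv; omega
    · intro s
      have h1 : rayFun G o s (n + 1) = x ↔ s y = c ∧ rayFun G o s n = y := by
        constructor
        · intro h
          have h2 : (s (rayFun G o s n)).1 = x := h
          have h3 : rayFun G o s n = y := by
            have h4 := (s (rayFun G o s n)).2
            rw [h2] at h4
            exact parent_unique hG.isTree h4.1 hy h4.2 (by omega)
          rw [h3] at h2
          exact ⟨Subtype.ext h2, h3⟩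
        · rintro ⟨h2, h3⟩
          change (s (rayFun G o s n)).1 = x
          rw [h3, h2]
      rw [h1, hst, Finset.coe_insert, Set.insert_pi]
      refine and_congr (by simp) ?_
      simp only [Set.mem_pi]
      refine forall₂_congr fun v hv => ?_
      rw [Function.update_of_ne (fun h : v = y => hyS (by rw [← h]; exact hv))]
    · rw [Finset.prod_insert hyS, Function.update_self, uniformOn_child]
      have h5 : ∏ v ∈ S, ProbabilityTheory.uniformOn (Set.univ : Set (Children G o v))
          (Function.update t y {c} v) = (sphereCard q n : ℝ≥0∞)⁻¹ := by
        rw [← hprod]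
        refine Finset.prod_congr rfl fun v hv => ?_
        rw [Function.update_of_ne (fun h : v = y => hyS (by rw [← h]; exact hv))]
      rw [h5, ← hyn, sphereCard_succ hG, Nat.cast_mul, ENNReal.mul_inv]
      · exact Or.inr (ENNReal.natCast_ne_top _)
      · exact Or.inl (ENNReal.natCast_ne_top _)

lemma measurable_ray [G.LocallyFinite] {q : ℕ} (hG : IsHomogeneousTree G q) :
    Measurable (ray G o) := by
  refine measurable_generateFrom ?_
  rintro _ ⟨x, rfl⟩
  obtain ⟨S, t, -, hst, -⟩ := exists_cylinder hG _ x rfl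
  have h : ray G o ⁻¹' sector G o x = Set.pi (S : Set V) t := by
    ext s
    rw [Set.mem_preimage, mem_sector hG.isTree.connected, ← hst]
    rfl
  rw [h]
  exact MeasurableSet.pi S.countable_toSet fun v _ => trivial

/-- The values of `ν` on the sectors. -/
theorem boundaryMeasure_sector [G.LocallyFinite] {q : ℕ} (hG : IsHomogeneousTree G q) (x : V) :
    boundaryMeasure G o (sector G o x) = (sphereCard q (G.dist o x) : ℝ≥0∞)⁻¹ := by
  have hne : ∀ v : V, Nonempty (Children G o v) := nonempty_children hG
  have hp : ∀ v : V, IsProbabilityMeasure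
      (ProbabilityTheory.uniformOn (Set.univ : Set (Children G o v))) := fun v =>
    ProbabilityTheory.isProbabilityMeasure_uniformOn Set.finite_univ Set.univ_nonempty
  obtain ⟨S, t, -, hst, hprod⟩ := exists_cylinder hG _ x rfl
  have h : ray G o ⁻¹' sector G o x = Set.pi (S : Set V) t := by
    ext s
    rw [Set.mem_preimage, mem_sector hG.isTree.connected, ← hst]
    rfl
  rw [boundaryMeasure, Measure.map_apply (measurable_ray hG)
    (MeasurableSpace.measurableSet_generateFrom ⟨x, rfl⟩), h,
    Measure.infinitePi_pi (μ := fun v : V =>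
      ProbabilityTheory.uniformOn (Set.univ : Set (Children G o v))) (fun _ _ => trivial), hprod]

theorem isProbabilityMeasure_boundaryMeasure [G.LocallyFinite] {q : ℕ}
    (hG : IsHomogeneousTree G q) : IsProbabilityMeasure (boundaryMeasure G o) := by
  constructor
  have h : (Set.univ : Set (Boundary G o)) = sector G o o := by
    ext ω
    simp [mem_sector hG.isTree.connected, ω.map_zero']
  rw [h, boundaryMeasure_sector hG]
  simp [sphereCard]

end Facts

section Transform

variable (G : SimpleGraph V) (q : ℕ) (o : V)

/-- The Poisson kernel `p(x, ω) = q ^ (2 |c(x, ω)| - |x|)`. -/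
def poissonKernel (x : V) (ω : Boundary G o) : ℝ :=
  (q : ℝ) ^ (2 * (G.dist o (confluent G o x ω) : ℤ) - (G.dist o x : ℤ))

/-- The power `p(x, ω) ^ (1/2 + i z)` of the Poisson kernel. -/
def kernelPow (z : ℂ) (x : V) (ω : Boundary G o) : ℂ :=
  (poissonKernel G q o x ω : ℂ) ^ (1 / 2 + Complex.I * z)

/-- The Poisson transform `𝒫_z F (x) = ∫ p(x, ω) ^ (1/2 + i z) F(ω) dν(ω)`. -/
def poissonTransform (z : ℂ) (F : Boundary G o → ℂ) (x : V) : ℂ :=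
  ∫ ω, kernelPow G q o z x ω * F ω ∂(boundaryMeasure G o)

/-- The Poisson transform `𝒫_z μ (x) = ∫ p(x, ω) ^ (1/2 + i z) dμ(ω)` of a complex measure `μ`. -/
def poissonTransformMeasure (z : ℂ) (μ : ComplexMeasure (Boundary G o)) (x : V) : ℂ :=
  VectorMeasure.integral μ (kernelPow G q o z x) (ContinuousLinearMap.mul ℝ ℂ)

/-- The elementary spherical function `φ_z = 𝒫_z 1`. -/
def spherical (z : ℂ) : V → ℂ :=
  poissonTransform G q o z fun _ => 1

/-- `ℒ u (x) = u(x) - (q + 1)⁻¹ ∑_{d(x, y) = 1} u(y)`. -/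
def laplacian [G.LocallyFinite] (u : V → ℂ) (x : V) : ℂ :=
  u x - (1 / ((q : ℂ) + 1)) * ∑ y ∈ G.neighborFinset x, u y

/-- `γ(z) = 1 - (q ^ (1/2 + i z) + q ^ (1/2 - i z)) / (q + 1)`. -/
def gammaEigenvalue (z : ℂ) : ℂ :=
  1 - ((q : ℂ) ^ (1 / 2 + Complex.I * z) + (q : ℂ) ^ (1 / 2 - Complex.I * z)) / ((q : ℂ) + 1)

/-- `τ = 2 π / log q`. -/
def tau : ℝ := 2 * Real.pi / Real.log q

/-- `δ_p = 1/p - 1/2`; for the conjugate exponent `p'` of `p` one has `δ_{p'} = -δ_p`. -/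
def delta (p : ℝ) : ℝ := 1 / p - 1 / 2

/-- The average of `f` over the sphere `S(o, n)`. -/
def sphereAverage (n : ℕ) (f : V → ℝ≥0∞) : ℝ≥0∞ :=
  (∑' y : {y : V // G.dist o y = n}, f y) / (sphereCard q n : ℝ≥0∞)

/-- The Hardy-type norm `‖u‖_{ℋ^r_p}`, with values in `[0, ∞]`: for `r < ∞` the supremum over `n` of
`φ_{iδ_p}(n)⁻¹` times the `L^r`-mean of `u` over `S(o, n)`, and for `r = ∞` the supremum over `x` of
`φ_{iδ_p}(x)⁻¹ |u(x)|`. Here `φ_{iδ_p}` is positive and radial, and its value `φ_{iδ_p}(n)` on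
`S(o, n)` is read off at the `n`-th vertex of a fixed boundary point `ω₀`. -/
def hardyNorm (ω₀ : Boundary G o) (p : ℝ) (r : ℝ≥0∞) (u : V → ℂ) : ℝ≥0∞ :=
  if r = ∞ then
    ⨆ x : V, ‖spherical G q o (Complex.I * (delta p : ℂ)) x‖ₑ⁻¹ * ‖u x‖ₑ
  else
    ⨆ n : ℕ, ‖spherical G q o (Complex.I * (delta p : ℂ)) (ω₀ n)‖ₑ⁻¹ *
      (sphereAverage G q o n fun y => ‖u y‖ₑ ^ r.toReal) ^ (1 / r.toReal)

end Transform

end HomTree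

end

noncomputable section

namespace HomTree

variable {V : Type u} {G : SimpleGraph V} {o : V}

/-! ### Combinatorics of geodesic rays in a tree -/

/-! Put `t = q^(1/2+iz)`. The choice of `z` gives `|t| = q^(1/p) > 1`, and for `p = 2` the
restriction on `α` gives `t² = q`. Along a ray the power of the Poisson kernel is `t^(2|c|-n)`, and
summing its jumps writes it as `t^(-n) (1 + (t²-1) ∑_{j<n} t^(2j) 1_{E(ω_{j+1})})`
(`kernelPow_ray`). A Poisson transform therefore depends only on the masses `v(x)` of the sectors;
this is `HasMass`. Since `t² ≠ 1`, the formula can be solved for `v` (`exists_hasMass`), and `u` is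
an eigenfunction exactly when `v` is additive over children (`HasMass.isFlow_iff`). It remains to
decide which additive `v` come from `L^r` functions or from measures.

Rescaled to densities `M_n = #S(o,n) · v(ω_n)`, additivity is the martingale property
(`martingale_massDensity`), and `t^n u(ω_n) = M_0 + c ∑_{j<n} β^j M_{j+1}` with `c = (t²-1)/(q+1)`
and `β = t²/q`. Sphere means become `L^r(ν)` norms (`hardyNorm_eq`).

Upper bound: `|𝒫_z F|` is dominated by the transform of `|F|` with the positive parameter `|t|`.
Minkowski's inequality and contractivity of conditional expectation then produce exactly the
spherical function.

Lower bound: conditioning `t^n u(ω_n)` on the first `k` steps replaces every later `M_{j+1}` by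
`M_k`, so `|c ∑_{k≤j<n} β^j| ‖M_k‖` is at most `‖t^n u(ω_n)‖ + ‖t^k u(ω_k)‖`. As `n → ∞` the sum on
the left grows at the rate of `|t|^n φ(n)`: geometrically if `p < 2`, where `|β| = q^(2/p-1) > 1`,
and linearly if `p = 2`, where `β = 1`. Comparing leading terms bounds all `‖M_k‖` by a multiple of
the Hardy norm (`HasMass.eLpNorm_massDensity_le`).

Conversely, a martingale bounded in `L^r`, `r > 1`, is closed by an `L^r` function
(`exists_memLp_of_massDensity`). For `r = 1`, an additive function of bounded variation is a
difference of nonnegative ones, and each of those is realised by a random ray with suitable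
transition probabilities (`exists_complexMeasure_of_massDensity`). -/

lemma Boundary.eq_of_le (hG : G.IsTree) {ω ω' : Boundary G o} {n : ℕ} (h : ω n = ω' n) {j : ℕ}
    (hj : j ≤ n) : ω j = ω' j := by
  induction n, hj using Nat.le_induction with
  | base => exact h
  | succ n _ ih =>
    refine ih (parent_unique (o := o) hG (ω.adj' n) (by rw [h]; exact ω'.adj' n) ?_ ?_)
    · rw [ω.dist', ω.dist']
    · rw [ω.dist', ω'.dist']

/-- Induction backwards from the far end: unless `y` is the endpoint, the last edge of the geodesic
from `y` to the endpoint must start at the parent of the endpoint, which is the preceding vertex of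
the ray. -/
lemma Boundary.eq_apply_of_dist_add (hG : G.IsTree) (ω : Boundary G o) {y : V} (n : ℕ)
    (h : G.dist o y + G.dist y (ω n) = n) : y = ω (G.dist o y) := by
  induction n with
  | zero =>
    have : G.dist o y = 0 := by omega
    rw [this, ω.map_zero']
    exact (hG.connected.dist_eq_zero_iff.1 this).symm
  | succ n ih =>
    by_cases hd : G.dist y (ω (n + 1)) = 0
    · have h1 := hG.connected.dist_eq_zero_iff.1 hd
      have h2 : G.dist o y = n + 1 := by omega
      rw [h2, h1]
    · obtain ⟨m, hm⟩ := Nat.exists_eq_succ_of_ne_zero hd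
      obtain ⟨x, hx, hxm⟩ := exists_parent (o := y) hG hm
      have h1 : G.dist o x ≤ G.dist o y + G.dist y x := hG.connected.dist_triangle
      have h2 : G.dist o (ω (n + 1)) ≤ G.dist o x + G.dist x (ω (n + 1)) :=
        hG.connected.dist_triangle
      rw [SimpleGraph.dist_eq_one_iff_adj.2 hx, ω.dist'] at h2
      have h3 : x = ω n := parent_unique (o := o) hG hx (ω.adj' n) (by rw [ω.dist']; omega)
        (by rw [ω.dist', ω.dist'])
      subst h3
      exact ih (by omega)

open Classical in
-- Turns the metric definition of the confluent into a comparison of two rays: the vertices on the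
-- geodesic from `o` to `ω' n` are exactly the `ω' j` with `j ≤ n`.
lemma dist_confluent_ray (hG : G.IsTree) (ω' ω : Boundary G o) (n : ℕ) :
    G.dist o (confluent G o (ω' n) ω) = Nat.findGreatest (fun j => ω j = ω' j) n := by
  rw [confluent, ω.dist', ω'.dist']
  have key : ∀ j ≤ n, (G.dist o (ω j) + G.dist (ω j) (ω' n) = n ↔ ω j = ω' j) := by
    intro j hj
    constructor
    · intro h
      have := ω'.eq_apply_of_dist_add hG n h
      rwa [ω.dist'] at this
    · intro h
      rw [h, ω'.dist']
      have h1 : ∀ m, G.dist (ω' j) (ω' (j + m)) ≤ m := by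
        intro m
        induction m with
        | zero => simp
        | succ m ih =>
          refine (hG.connected.dist_triangle (v := ω' (j + m))).trans ?_
          rw [← add_assoc, SimpleGraph.dist_eq_one_iff_adj.2 (ω'.adj' (j + m))]
          omega
      have h2 : G.dist o (ω' n) ≤ G.dist o (ω' j) + G.dist (ω' j) (ω' n) :=
        hG.connected.dist_triangle
      have h3 := h1 (n - j)
      rw [Nat.add_sub_cancel' hj] at h3
      rw [ω'.dist', ω'.dist'] at h2
      omega
  have h0 : ω 0 = ω' 0 := by rw [ω.map_zero', ω'.map_zero']
  refine le_antisymm ?_ ?_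
  · refine Nat.le_findGreatest (Nat.findGreatest_le _) ((key _ (Nat.findGreatest_le _)).1 ?_)
    exact Nat.findGreatest_spec
      (P := fun j => G.dist o (ω j) + G.dist (ω j) (ω' n) = n) (Nat.zero_le n)
      ((key 0 (Nat.zero_le n)).2 h0)
  · refine Nat.le_findGreatest (Nat.findGreatest_le _) ((key _ (Nat.findGreatest_le _)).2 ?_)
    exact Nat.findGreatest_spec (P := fun j => ω j = ω' j) (Nat.zero_le n) h0

open Classical in
variable (G o) in
/-- The finite set of neighbours of `x` that are farther from `o` than `x`. -/
def childFinset [G.LocallyFinite] (x : V) : Finset V :=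
  (G.neighborFinset x).filter fun y => G.dist o y = G.dist o x + 1

/-! ### Children, spheres and rays through a given vertex -/

section LocallyFinite

variable [G.LocallyFinite] {q : ℕ}

lemma mem_childFinset {x y : V} :
    y ∈ childFinset G o x ↔ G.Adj x y ∧ G.dist o y = G.dist o x + 1 := by
  simp [childFinset]

lemma card_childFinset (x : V) : (childFinset G o x).card = Nat.card (Children G o x) :=
  (Nat.subtype_card (p := fun y => G.Adj x y ∧ G.dist o y = G.dist o x + 1) (childFinset G o x)
    fun _ => mem_childFinset).symm

lemma Boundary.mem_childFinset (ω : Boundary G o) (n : ℕ) :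
    ω (n + 1) ∈ childFinset G o (ω n) :=
  HomTree.mem_childFinset.2 ⟨ω.adj' n, by rw [ω.dist', ω.dist']⟩

lemma neighborFinset_root : G.neighborFinset o = childFinset G o o := by
  ext y
  rw [mem_childFinset, SimpleGraph.mem_neighborFinset, SimpleGraph.dist_self, zero_add,
    SimpleGraph.dist_eq_one_iff_adj, and_self_iff]

lemma Boundary.notMem_childFinset (ω : Boundary G o) (n : ℕ) :
    ω n ∉ childFinset G o (ω (n + 1)) := by
  rw [HomTree.mem_childFinset, ω.dist', ω.dist']
  omega

open Classical in
lemma Boundary.neighborFinset_succ (hG : G.IsTree) (ω : Boundary G o) (n : ℕ) :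
    G.neighborFinset (ω (n + 1)) = insert (ω n) (childFinset G o (ω (n + 1))) := by
  ext y
  rw [Finset.mem_insert, HomTree.mem_childFinset, SimpleGraph.mem_neighborFinset]
  constructor
  · intro h
    rcases hG.dist_eq_dist_add_one_of_adj o h with h1 | h1
    · exact Or.inl (parent_unique (o := o) hG h.symm (ω.adj' n) h1 (by rw [ω.dist', ω.dist']))
    · exact Or.inr ⟨h, h1⟩
  · rintro (rfl | h)
    · exact (ω.adj' n).symm
    · exact h.1

/-- The sector of `x` has positive measure, hence is not empty. -/
lemma exists_ray (hG : IsHomogeneousTree G q) (x : V) :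
    ∃ ω : Boundary G o, ω (G.dist o x) = x := by
  have h : boundaryMeasure G o (sector G o x) ≠ 0 := by
    rw [boundaryMeasure_sector hG]
    exact ENNReal.inv_ne_zero.2 (ENNReal.natCast_ne_top _)
  obtain ⟨ω, hω⟩ := nonempty_of_measure_ne_zero h
  exact ⟨ω, (mem_sector hG.isTree.connected).1 hω⟩

lemma exists_ray_child (hG : IsHomogeneousTree G q) (ω : Boundary G o) {n : ℕ} {y : V}
    (hy : y ∈ childFinset G o (ω n)) :
    ∃ ω' : Boundary G o, ω' (n + 1) = y ∧ ∀ j ≤ n, ω' j = ω j := by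
  obtain ⟨ω', h⟩ := exists_ray (o := o) hG y
  rw [mem_childFinset, ω.dist'] at hy
  rw [hy.2] at h
  refine ⟨ω', h, fun j hj => Boundary.eq_of_le hG.isTree (n := n) ?_ hj⟩
  refine parent_unique (o := o) hG.isTree (z := y) ?_ hy.1 ?_ ?_
  · rw [← h]; exact ω'.adj' n
  · rw [ω'.dist', hy.2]
  · rw [ω.dist', hy.2]

lemma finite_sphere (hG : G.IsTree) (n : ℕ) : {x : V | G.dist o x = n}.Finite := by
  induction n with
  | zero =>
    refine (Set.finite_singleton o).subset fun x hx => ?_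
    exact (hG.connected.dist_eq_zero_iff.1 hx).symm
  | succ n ih =>
    refine (ih.biUnion fun x _ => (G.neighborFinset x).finite_toSet).subset fun y hy => ?_
    obtain ⟨x, hx, hxn⟩ := exists_parent hG hy
    exact Set.mem_biUnion (show x ∈ {x : V | G.dist o x = n} from hxn)
      (by simpa using hx)

end LocallyFinite

lemma mem_sector_ray (hG : G.IsTree) {ω' ω : Boundary G o} {n : ℕ} :
    ω ∈ sector G o (ω' n) ↔ ω n = ω' n := by
  rw [mem_sector hG.connected, ω'.dist']

/-! ### The Poisson kernel along a ray -/

/-- `q ^ (1/2 + i z)`. -/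
def poissonBase (q : ℕ) (z : ℂ) : ℂ := (q : ℂ) ^ (1 / 2 + Complex.I * z)

lemma poissonBase_ne_zero {q : ℕ} (hq : 2 ≤ q) (z : ℂ) : poissonBase q z ≠ 0 := by
  rw [poissonBase, Ne, Complex.cpow_eq_zero_iff]
  rintro ⟨h, -⟩
  have : q = 0 := by exact_mod_cast h
  omega

/-- If the rays agree exactly up to level `m` within the first `n` steps, the indicators select `j <
m`, and the geometric sum collapses to `t^(2m)`. The kernel becomes a combination of indicators of
sectors, which can be integrated against any additive set function. -/
lemma kernelPow_ray (hG : G.IsTree) {q : ℕ} (z : ℂ) (hq : 2 ≤ q) (ω' ω : Boundary G o) (n : ℕ) :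
    kernelPow G q o z (ω' n) ω = (poissonBase q z ^ n)⁻¹ * (1 + (poissonBase q z ^ 2 - 1) *
      ∑ j ∈ Finset.range n,
        (poissonBase q z ^ 2) ^ j * (sector G o (ω' (j + 1))).indicator (fun _ => 1) ω) := by
  classical
  set t := poissonBase q z with ht
  have ht0 : t ≠ 0 := poissonBase_ne_zero hq z
  set m := Nat.findGreatest (fun j => ω j = ω' j) n with hm
  have hmn : m ≤ n := Nat.findGreatest_le _
  have hωm : ω m = ω' m := Nat.findGreatest_spec (P := fun j => ω j = ω' j) (Nat.zero_le n)
    (by rw [ω.map_zero', ω'.map_zero'])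
  have h1 : kernelPow G q o z (ω' n) ω = t ^ (2 * (m : ℤ) - n) := by
    rw [kernelPow, poissonKernel, dist_confluent_ray hG, ω'.dist', ← hm, ht, poissonBase]
    have hq0 : (0 : ℝ) ≤ q := Nat.cast_nonneg q
    rw [← Real.rpow_intCast, ← Complex.cpow_mul_ofReal_nonneg hq0,
      Complex.ofReal_intCast, Complex.cpow_int_mul, Complex.ofReal_natCast]
  have h2 : ∑ j ∈ Finset.range n, (t ^ 2) ^ j * (sector G o (ω' (j + 1))).indicator (fun _ => 1) ω
      = ∑ j ∈ Finset.range m, (t ^ 2) ^ j := by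
    rw [← Finset.sum_subset (Finset.range_mono hmn)]
    · refine Finset.sum_congr rfl fun j hj => ?_
      rw [Set.indicator_of_mem, mul_one]
      exact (mem_sector_ray hG).2 (Boundary.eq_of_le hG hωm (Finset.mem_range.1 hj))
    · intro j hj hj'
      rw [Set.indicator_of_notMem, mul_zero]
      intro h
      refine hj' (Finset.mem_range.2 ?_)
      have := Nat.le_findGreatest (P := fun j => ω j = ω' j) (Finset.mem_range.1 hj)
        ((mem_sector_ray hG).1 h)
      exact this
  rw [h1, h2, mul_geom_sum, add_sub_cancel, zpow_sub₀ ht0, zpow_mul, zpow_natCast, zpow_natCast,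
    div_eq_inv_mul]
  norm_cast

/-! ### Transforms of mass functions, flows and the Laplacian -/

variable (G o) in
/-- `u` is the Poisson transform, with parameter `t = q ^ (1/2 + i z)`, of the finitely additive set
function which has the value `v x` on the sector `E(x)`. -/
def HasMass (t : ℂ) (v u : V → ℂ) : Prop :=
  ∀ (ω : Boundary G o) (n : ℕ),
    u (ω n) = (t ^ n)⁻¹ * (v o + (t ^ 2 - 1) * ∑ j ∈ Finset.range n, (t ^ 2) ^ j * v (ω (j + 1)))

lemma Boundary.ne_root (ω : Boundary G o) (n : ℕ) : ω (n + 1) ≠ o := by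
  intro h
  have := ω.dist' (n + 1)
  rw [h, SimpleGraph.dist_self] at this
  omega

section Flow

variable [G.LocallyFinite] {q : ℕ}

variable (G o) in
/-- `v` is additive: the mass of a sector is the sum of the masses of its children. -/
def IsFlow {E : Type*} [AddCommMonoid E] (v : V → E) : Prop :=
  ∀ x, v x = ∑ y ∈ childFinset G o x, v y

lemma ext_of_ray (hG : IsHomogeneousTree G q) (o : V) {α : Type*} {f g : V → α}
    (h : ∀ (ω : Boundary G o) n, f (ω n) = g (ω n)) : f = g := by
  funext x
  obtain ⟨ω, hω⟩ := exists_ray (o := o) hG x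
  rw [← hω, h]

lemma HasMass.unique (hG : IsHomogeneousTree G q) {t : ℂ} {v u u' : V → ℂ}
    (h : HasMass G o t v u) (h' : HasMass G o t v u') : u = u' :=
  ext_of_ray hG o fun ω n => by rw [h, h']

lemma HasMass.apply_root (hG : IsHomogeneousTree G q) {t : ℂ} {v u : V → ℂ}
    (h : HasMass G o t v u) : u o = v o := by
  obtain ⟨ω, -⟩ := exists_ray (o := o) hG o
  have := h ω 0
  simpa [ω.map_zero'] using this

/-- One-step form of the defining formula. It depends only on the parent and the child, not on the
ray, and drives the computation of the Laplacian. -/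
lemma HasMass.apply_child (hG : IsHomogeneousTree G q) {t : ℂ} (ht : t ≠ 0) {v u : V → ℂ}
    (h : HasMass G o t v u) (ω : Boundary G o) {n : ℕ} {y : V} (hy : y ∈ childFinset G o (ω n)) :
    u y = t⁻¹ * u (ω n) + t⁻¹ * (t ^ 2 - 1) * t ^ n * v y := by
  obtain ⟨ω', rfl, hω'⟩ := exists_ray_child hG ω hy
  rw [← hω' n le_rfl, h ω' (n + 1), h ω' n, Finset.sum_range_succ]
  field_simp
  ring

lemma HasMass.sum_children (hG : IsHomogeneousTree G q) {t : ℂ} (ht : t ≠ 0) {v u : V → ℂ}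
    (h : HasMass G o t v u) (ω : Boundary G o) (n : ℕ) :
    ∑ y ∈ childFinset G o (ω n), u y = (childFinset G o (ω n)).card * t⁻¹ * u (ω n) +
      t⁻¹ * (t ^ 2 - 1) * t ^ n * ∑ y ∈ childFinset G o (ω n), v y := by
  rw [Finset.sum_congr rfl fun y hy => h.apply_child hG ht ω hy, Finset.sum_add_distrib,
    Finset.sum_const, nsmul_eq_mul, ← Finset.mul_sum]
  ring

/-- The transform of a mass function is an eigenfunction iff the mass function is additive. -/
lemma HasMass.isFlow_iff (hG : IsHomogeneousTree G q) {t : ℂ} (ht : t ≠ 0) (ht' : t ^ 2 ≠ 1)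
    {v u : V → ℂ} (h : HasMass G o t v u) :
    IsFlow G o v ↔ ∀ x, ∑ y ∈ G.neighborFinset x, u y = (t + q / t) * u x := by
  classical
  have ht'' : t ^ 2 - 1 ≠ 0 := sub_ne_zero.2 ht'
  have key : ∀ (ω : Boundary G o) n, v (ω n) = ∑ y ∈ childFinset G o (ω n), v y ↔
      ∑ y ∈ G.neighborFinset (ω n), u y = (t + q / t) * u (ω n) := by
    intro ω n
    cases n with
    | zero =>
      have h1 := h.sum_children hG ht ω 0
      rw [ω.map_zero', card_childFinset, card_children_root hG] at h1
      rw [ω.map_zero', neighborFinset_root (G := G), h1, h.apply_root hG]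
      generalize (∑ y ∈ childFinset G o o, v y) = S
      push_cast
      constructor
      · rintro rfl
        field_simp
        ring
      · intro h2
        field_simp at h2
        have : (t ^ 2 - 1) * (v o - S) = 0 := by linear_combination -h2
        rcases mul_eq_zero.1 this with h3 | h3
        · exact absurd h3 ht''
        · exact sub_eq_zero.1 h3
    | succ n =>
      have h1 := h.sum_children hG ht ω (n + 1)
      have h2 := h.apply_child hG ht ω (ω.mem_childFinset n)
      rw [card_childFinset, card_children_of_ne hG (ω.ne_root n)] at h1
      rw [ω.neighborFinset_succ hG.isTree, Finset.sum_insert (ω.notMem_childFinset n), h1]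
      generalize (∑ y ∈ childFinset G o (ω (n + 1)), v y) = S
      -- The one-step recursion is solved for the value at the parent, so that the neighbour sum
      -- involves only `u` at the vertex itself.
      have h3 : u (ω n) = t * u (ω (n + 1)) - (t ^ 2 - 1) * t ^ n * v (ω (n + 1)) := by
        rw [h2]; field_simp; ring
      rw [h3]
      -- The neighbour sum differs from the eigenvalue equation by the defect of additivity at this
      -- vertex, times a factor that is nonzero because `t ≠ 0` and `t² ≠ 1`.
      have e : t * u (ω (n + 1)) - (t ^ 2 - 1) * t ^ n * v (ω (n + 1)) +
          (q * t⁻¹ * u (ω (n + 1)) + t⁻¹ * (t ^ 2 - 1) * t ^ (n + 1) * S) =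
          (t + q / t) * u (ω (n + 1)) + (t ^ 2 - 1) * t ^ n * (S - v (ω (n + 1))) := by
        field_simp; ring
      rw [e, add_eq_left, mul_eq_zero, mul_eq_zero, sub_eq_zero (a := S), eq_comm]
      simp [ht'', ht]
  constructor
  · intro hv x
    obtain ⟨ω, hω⟩ := exists_ray (o := o) hG x
    rw [← hω, ← key, ← hv]
  · intro hu x
    obtain ⟨ω, hω⟩ := exists_ray (o := o) hG x
    rw [← hω, key, hu]

open Classical in
/-- Every function is the transform of a mass function. -/
lemma exists_hasMass (hG : IsHomogeneousTree G q) (o : V) {t : ℂ} (ht : t ≠ 0) (ht' : t ^ 2 ≠ 1)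
    (u : V → ℂ) : ∃ v, HasMass G o t v u := by
  have ht'' : t ^ 2 - 1 ≠ 0 := sub_ne_zero.2 ht'
  -- The one-step recursion prescribes the mass at `x`. The prescription does not depend on the ray
  -- chosen through `x`, since all such rays agree up to `x`.
  have h1 : ∀ x, ∃ c : ℂ, (x = o → c = u o) ∧
      ∀ (ω : Boundary G o) n, ω (n + 1) = x →
        u x = t⁻¹ * u (ω n) + t⁻¹ * (t ^ 2 - 1) * t ^ n * c := by
    intro x
    obtain ⟨ω, hω⟩ := exists_ray (o := o) hG x
    by_cases hx : x = o
    · exact ⟨u o, fun _ => rfl, fun ω n h => absurd (h.trans hx) (ω.ne_root n)⟩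
    · have hpos : G.dist o x ≠ 0 := fun h => hx (hG.isTree.connected.dist_eq_zero_iff.1 h).symm
      obtain ⟨m, hm⟩ := Nat.exists_eq_succ_of_ne_zero hpos
      rw [hm] at hω
      refine ⟨(u x - t⁻¹ * u (ω m)) / (t⁻¹ * (t ^ 2 - 1) * t ^ m), fun h => absurd h hx, ?_⟩
      intro ω' n h
      have hnm : n = m := by
        have := ω'.dist' (n + 1)
        rw [h] at this
        omega
      subst hnm
      rw [Boundary.eq_of_le hG.isTree (ω := ω') (ω' := ω) (h.trans hω.symm) (Nat.le_succ n)]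
      field_simp
      ring
  choose v hv0 hv using h1
  refine ⟨v, fun ω n => ?_⟩
  induction n with
  | zero => simp [ω.map_zero', hv0 o rfl]
  | succ n ih =>
    rw [hv _ ω n rfl, ih, Finset.sum_range_succ]
    field_simp
    ring

end Flow

/-- With `t = q^(1/2+iz)` one has `q^(1/2-iz) = q/t`, so the eigenvalue is algebraic in `t`. -/
lemma laplacian_eq_iff [G.LocallyFinite] {q : ℕ} (hq : 2 ≤ q) (z : ℂ) (u : V → ℂ) :
    laplacian G q u = (fun x => gammaEigenvalue q z * u x) ↔
      ∀ x, ∑ y ∈ G.neighborFinset x, u y =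
        (poissonBase q z + q / poissonBase q z) * u x := by
  have hq0 : (q : ℂ) ≠ 0 := by
    have : q ≠ 0 := by omega
    exact_mod_cast this
  have hq1 : (q : ℂ) + 1 ≠ 0 := by exact_mod_cast Nat.succ_ne_zero q
  have h1 : (q : ℂ) ^ (1 / 2 - Complex.I * z) = q / poissonBase q z := by
    rw [show (1 / 2 - Complex.I * z : ℂ) = 1 - (1 / 2 + Complex.I * z) by ring,
      Complex.cpow_sub _ _ hq0, Complex.cpow_one, poissonBase]
  rw [funext_iff]
  refine forall_congr' fun x => ?_
  rw [laplacian, gammaEigenvalue, h1, ← poissonBase]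
  generalize poissonBase q z + q / poissonBase q z = c
  generalize (∑ y ∈ G.neighborFinset x, u y) = S
  constructor
  · intro h
    field_simp at h
    linear_combination -h
  · rintro rfl
    field_simp

/-! ### The filtration generated by the vertices of a ray -/

lemma measurableSet_sector (x : V) : MeasurableSet (sector G o x) :=
  MeasurableSpace.measurableSet_generateFrom ⟨x, rfl⟩

lemma sphereCard_pos {q : ℕ} (hq : 2 ≤ q) (n : ℕ) : 0 < sphereCard q n := by
  rw [sphereCard]
  split_ifs
  · exact one_pos
  · positivity

lemma disjoint_sector (hG : G.IsTree) {x y : V} (h : G.dist o x = G.dist o y) (hxy : x ≠ y) :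
    Disjoint (sector G o x) (sector G o y) := by
  rw [Set.disjoint_left]
  intro ω h1 h2
  rw [mem_sector hG.connected] at h1 h2
  exact hxy (by rw [← h1, ← h2, h])

lemma sector_root (hG : G.IsTree) : sector G o o = Set.univ := by
  ext ω
  simp [mem_sector hG.connected, ω.map_zero']

section LocallyFinite

variable [G.LocallyFinite] {q : ℕ}

/-- The sphere of radius `n` centred at `o`. -/
def sphereFinset (hG : G.IsTree) (o : V) (n : ℕ) : Finset V := (finite_sphere (o := o) hG n).toFinset

lemma mem_sphereFinset (hG : G.IsTree) {n : ℕ} {x : V} :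
    x ∈ sphereFinset hG o n ↔ G.dist o x = n := by
  simp [sphereFinset]

/-- Events depending on the `n`-th vertex are finite unions of sectors at level `n`, which are
disjoint. Measurability and integrals over such events thus reduce to single sectors. -/
lemma exists_preimage_eval (hG : G.IsTree) (n : ℕ) (A : Set V) :
    ∃ T : Finset V, (∀ x ∈ T, G.dist o x = n) ∧
      (fun ω : Boundary G o => ω n) ⁻¹' A = ⋃ x ∈ T, sector G o x := by
  classical
  refine ⟨(sphereFinset hG o n).filter (· ∈ A), fun x hx => ?_, ?_⟩
  · exact (mem_sphereFinset hG).1 (Finset.mem_filter.1 hx).1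
  · ext ω
    simp only [Set.mem_preimage, Finset.mem_filter, Set.mem_iUnion, exists_prop, mem_sphereFinset,
      mem_sector hG.connected]
    constructor
    · intro h
      exact ⟨ω n, ⟨ω.dist' n, h⟩, by rw [ω.dist']⟩
    · rintro ⟨x, ⟨h1, h2⟩, h3⟩
      rw [h1] at h3
      rwa [h3]

lemma measurableSet_preimage_eval (hG : G.IsTree) (n : ℕ) (A : Set V) :
    MeasurableSet ((fun ω : Boundary G o => ω n) ⁻¹' A) := by
  obtain ⟨T, -, h⟩ := exists_preimage_eval (o := o) hG n A
  rw [h]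
  exact T.measurableSet_biUnion fun x _ => measurableSet_sector x

/-- The filtration on `Ω` in which the `n`-th `σ`-algebra is generated by `ω ↦ ω n`. -/
def rayFiltration (hG : G.IsTree) (o : V) :
    Filtration ℕ (Boundary.instMeasurableSpace G o) where
  seq n := MeasurableSpace.comap (fun ω : Boundary G o => ω n) ⊤
  mono' := by
    refine monotone_nat_of_le_succ fun n => ?_
    rintro _ ⟨A, -, rfl⟩
    -- The vertex `ω (n + 1)` determines its parent `ω n`, so an event at level `n` is also an event
    -- at level `n + 1`.
    refine ⟨{x | ∃ ω : Boundary G o, ω n ∈ A ∧ ω (n + 1) = x}, trivial, ?_⟩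
    ext ω
    simp only [Set.mem_preimage, Set.mem_ofPred_eq]
    constructor
    · rintro ⟨ω', h1, h2⟩
      rwa [← Boundary.eq_of_le hG h2 (Nat.le_succ n)]
    · exact fun h => ⟨ω, h, rfl⟩
  le' n := by
    rintro _ ⟨A, -, rfl⟩
    exact measurableSet_preimage_eval hG n A

lemma stronglyMeasurable_eval (hG : G.IsTree) {E : Type*} [TopologicalSpace E]
    [TopologicalSpace.PseudoMetrizableSpace E] [SecondCountableTopology E]
    (n : ℕ) (f : V → E) :
    StronglyMeasurable[rayFiltration hG o n] fun ω : Boundary G o => f (ω n) := by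
  borelize E
  refine Measurable.stronglyMeasurable ?_
  intro s _
  exact ⟨f ⁻¹' s, trivial, rfl⟩

lemma stronglyMeasurable_eval' (hG : G.IsTree) {E : Type*} [TopologicalSpace E]
    [TopologicalSpace.PseudoMetrizableSpace E] [SecondCountableTopology E]
    (n : ℕ) (f : V → E) : StronglyMeasurable fun ω : Boundary G o => f (ω n) :=
  (stronglyMeasurable_eval hG n f).mono ((rayFiltration hG o).le n)

lemma iSup_rayFiltration (hG : G.IsTree) (o : V) :
    ⨆ n, rayFiltration hG o n = Boundary.instMeasurableSpace G o := by
  refine le_antisymm (iSup_le fun n => (rayFiltration hG o).le n) ?_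
  refine MeasurableSpace.generateFrom_le ?_
  rintro _ ⟨x, rfl⟩
  refine le_iSup (rayFiltration hG o) (G.dist o x) _ ⟨{x}, trivial, ?_⟩
  ext ω
  rw [mem_sector hG.connected]
  rfl

lemma boundaryMeasure_real_sector (hG : IsHomogeneousTree G q) (x : V) :
    (boundaryMeasure G o).real (sector G o x) = (sphereCard q (G.dist o x) : ℝ)⁻¹ := by
  rw [measureReal_def, boundaryMeasure_sector hG, ENNReal.toReal_inv, ENNReal.toReal_natCast]

/-- The integrand is constant on the sectors of level `n`, which all have measure `1 / sphereCard q
n`. This identifies means over spheres with integrals over the boundary. -/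
lemma lintegral_eval (hG : IsHomogeneousTree G q) (n : ℕ) (f : V → ℝ≥0∞) :
    ∫⁻ ω, f (ω n) ∂(boundaryMeasure G o) =
      (∑ x ∈ sphereFinset hG.isTree o n, f x) / sphereCard q n := by
  have h1 : ∀ ω : Boundary G o, f (ω n) =
      ∑ x ∈ sphereFinset hG.isTree o n, (sector G o x).indicator (fun _ => f x) ω := by
    intro ω
    rw [Finset.sum_eq_single (ω n), Set.indicator_of_mem]
    · rw [mem_sector_ray hG.isTree]
    · intro x hx hxω
      rw [Set.indicator_of_notMem]
      rw [mem_sector hG.isTree.connected, (mem_sphereFinset hG.isTree).1 hx]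
      exact fun h => hxω h.symm
    · intro h
      exact absurd ((mem_sphereFinset hG.isTree).2 (ω.dist' n)) h
  simp_rw [h1]
  rw [lintegral_finsetSum _ fun x _ => measurable_const.indicator (measurableSet_sector x),
    div_eq_mul_inv, Finset.sum_mul]
  refine Finset.sum_congr rfl fun x hx => ?_
  rw [lintegral_indicator_const (measurableSet_sector x), boundaryMeasure_sector hG,
    (mem_sphereFinset hG.isTree).1 hx]

lemma sphereAverage_eq_lintegral (hG : IsHomogeneousTree G q) (n : ℕ) (f : V → ℝ≥0∞) :
    sphereAverage G q o n f = ∫⁻ ω, f (ω n) ∂(boundaryMeasure G o) := by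
  rw [lintegral_eval hG, sphereAverage]
  congr 1
  refine (tsum_subtype {y : V | G.dist o y = n} f).trans ?_
  rw [tsum_eq_sum (s := sphereFinset hG.isTree o n)]
  · refine Finset.sum_congr rfl fun x hx => ?_
    exact Set.indicator_of_mem (show x ∈ {y : V | G.dist o y = n} from
      (mem_sphereFinset hG.isTree).1 hx) f
  · intro x hx
    exact Set.indicator_of_notMem (fun h : x ∈ {y : V | G.dist o y = n} =>
      hx ((mem_sphereFinset hG.isTree).2 h)) f

lemma integrable_eval (hG : IsHomogeneousTree G q) {E : Type*} [NormedAddCommGroup E]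
    [SecondCountableTopology E] (n : ℕ) (f : V → E) :
    Integrable (fun ω : Boundary G o => f (ω n)) (boundaryMeasure G o) := by
  refine ⟨(stronglyMeasurable_eval' hG.isTree n f).aestronglyMeasurable, ?_⟩
  rw [HasFiniteIntegral, lintegral_eval hG n fun x => ‖f x‖ₑ]
  refine ENNReal.div_lt_top (ENNReal.sum_lt_top.2 fun x _ => enorm_lt_top).ne ?_
  exact_mod_cast (sphereCard_pos hG.two_le n).ne'

lemma setIntegral_sector_eval (hG : IsHomogeneousTree G q) {E : Type*} [NormedAddCommGroup E]
    [NormedSpace ℝ E] [CompleteSpace E] {n : ℕ} {x : V} (hx : G.dist o x = n) (f : V → E) :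
    ∫ ω in sector G o x, f (ω n) ∂(boundaryMeasure G o) = (sphereCard q n : ℝ)⁻¹ • f x := by
  have h1 : ∫ ω in sector G o x, f (ω n) ∂(boundaryMeasure G o) =
      ∫ ω in sector G o x, f x ∂(boundaryMeasure G o) := by
    refine setIntegral_congr_fun (measurableSet_sector x) fun ω hω => ?_
    rw [mem_sector hG.isTree.connected, hx] at hω
    simp only [hω]
  rw [h1, setIntegral_const, boundaryMeasure_real_sector hG, hx]

lemma eval_ae_eq_condExp (hG : IsHomogeneousTree G q) {E : Type*} [NormedAddCommGroup E]
    [NormedSpace ℝ E] [CompleteSpace E] [SecondCountableTopology E] {n : ℕ} {f : V → E}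
    {F : Boundary G o → E} (hF : Integrable F (boundaryMeasure G o))
    (h : ∀ x, G.dist o x = n →
      ∫ ω in sector G o x, F ω ∂(boundaryMeasure G o) = (sphereCard q n : ℝ)⁻¹ • f x) :
    (fun ω : Boundary G o => f (ω n)) =ᵐ[boundaryMeasure G o]
      (boundaryMeasure G o)[F | rayFiltration hG.isTree o n] := by
  have := isProbabilityMeasure_boundaryMeasure (o := o) hG
  refine ae_eq_condExp_of_forall_setIntegral_eq ((rayFiltration hG.isTree o).le n) hF
    (fun s _ _ => (integrable_eval hG n f).integrableOn) ?_
    (stronglyMeasurable_eval hG.isTree n f).aestronglyMeasurable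
  rintro _ ⟨A, -, rfl⟩ -
  obtain ⟨T, hT, hA⟩ := exists_preimage_eval (o := o) hG.isTree n A
  rw [hA, integral_biUnion_finset T (fun x _ => measurableSet_sector x) ?_
    (fun x _ => (integrable_eval hG n f).integrableOn),
    integral_biUnion_finset T (fun x _ => measurableSet_sector x) ?_
    (fun x _ => hF.integrableOn)]
  · refine Finset.sum_congr rfl fun x hx => ?_
    rw [h x (hT x hx), setIntegral_sector_eval hG (hT x hx)]
  all_goals
    intro x hx y hy hxy
    exact disjoint_sector hG.isTree ((hT x hx).trans (hT y hy).symm) hxy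

/-! ### Partition of a sector into the sectors of the children -/

lemma sector_eq_biUnion (hG : G.IsTree) (x : V) :
    sector G o x = ⋃ y ∈ childFinset G o x, sector G o y := by
  ext ω
  simp only [Set.mem_iUnion, exists_prop, mem_sector hG.connected]
  constructor
  · intro h
    have := ω.mem_childFinset (G.dist o x)
    rw [h] at this
    exact ⟨_, this, by rw [ω.dist']⟩
  · rintro ⟨y, hy, h⟩
    rw [mem_childFinset] at hy
    rw [hy.2] at h
    refine parent_unique (o := o) hG (z := y) (by rw [← h]; exact ω.adj' _) hy.1 ?_ hy.2
    rw [ω.dist', hy.2]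

lemma pairwiseDisjoint_sector_children (hG : G.IsTree) (x : V) :
    (childFinset G o x : Set V).PairwiseDisjoint (sector G o) := by
  intro y hy z hz hyz
  have hy' := mem_childFinset.1 (Finset.mem_coe.1 hy)
  have hz' := mem_childFinset.1 (Finset.mem_coe.1 hz)
  exact disjoint_sector hG (hy'.2.trans hz'.2.symm) hyz

lemma isFlow_setIntegral (hG : G.IsTree) {E : Type*} [NormedAddCommGroup E] [NormedSpace ℝ E]
    {μ : Measure (Boundary G o)} {F : Boundary G o → E} (hF : Integrable F μ) :
    IsFlow G o fun x => ∫ ω in sector G o x, F ω ∂μ := by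
  intro x
  simp only
  rw [sector_eq_biUnion hG x, integral_biUnion_finset _ (fun y _ => measurableSet_sector y)
    (pairwiseDisjoint_sector_children hG x) (fun y _ => hF.integrableOn)]

lemma isFlow_vectorMeasure (hG : G.IsTree) {E : Type*} [AddCommGroup E] [TopologicalSpace E]
    [T2Space E] (μ : VectorMeasure (Boundary G o) E) :
    IsFlow G o fun x => μ (sector G o x) := by
  intro x
  simp only
  rw [sector_eq_biUnion hG x, VectorMeasure.of_biUnion_finset
    (pairwiseDisjoint_sector_children hG x) (fun y _ => measurableSet_sector y)]

/-! ### Poisson transforms of functions and measures -/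

/-- Integration of the expansion of the kernel into indicators of sectors, term by term. -/
lemma hasMass_poissonTransform (hG : IsHomogeneousTree G q) (z : ℂ) {F : Boundary G o → ℂ}
    (hF : Integrable F (boundaryMeasure G o)) :
    HasMass G o (poissonBase q z) (fun x => ∫ ω in sector G o x, F ω ∂(boundaryMeasure G o))
      (poissonTransform G q o z F) := by
  intro ω' n
  have h1 : ∀ ω, kernelPow G q o z (ω' n) ω * F ω = (poissonBase q z ^ n)⁻¹ *
      (F ω + (poissonBase q z ^ 2 - 1) * ∑ j ∈ Finset.range n,
        (poissonBase q z ^ 2) ^ j * (sector G o (ω' (j + 1))).indicator F ω) := by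
    intro ω
    rw [kernelPow_ray hG.isTree z hG.two_le, mul_assoc, add_mul, one_mul, mul_assoc,
      Finset.sum_mul]
    congr 4
    ext j
    rw [mul_assoc]
    congr 1
    by_cases h : ω ∈ sector G o (ω' (j + 1)) <;> simp [h]
  have h2 : ∀ j, Integrable (fun ω => (poissonBase q z ^ 2) ^ j *
      (sector G o (ω' (j + 1))).indicator F ω) (boundaryMeasure G o) := fun j =>
    (hF.indicator (measurableSet_sector _)).const_mul _
  rw [poissonTransform]
  simp_rw [h1]
  rw [integral_const_mul, integral_add hF ((integrable_finsetSum _ fun j _ => h2 j).const_mul _),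
    integral_const_mul, integral_finsetSum _ fun j _ => h2 j]
  simp_rw [integral_const_mul, integral_indicator (measurableSet_sector _)]
  rw [sector_root hG.isTree, setIntegral_univ]

/-- The variation is dominated by the sum of the total variations of the real and imaginary parts,
which are finite. -/
lemma isFiniteMeasure_variation {α : Type*} [MeasurableSpace α] (μ : ComplexMeasure α) :
    IsFiniteMeasure μ.variation := by
  set m : Measure α := (ComplexMeasure.re μ).totalVariation + (ComplexMeasure.im μ).totalVariation
  refine isFiniteMeasure_of_le m (VectorMeasure.variation_le_of_forall_enorm_le fun E hE => ?_)
  have h1 : μ E = ((ComplexMeasure.re μ E : ℝ) : ℂ) + (ComplexMeasure.im μ E : ℝ) * Complex.I :=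
    (Complex.re_add_im _).symm
  rw [h1]
  refine (enorm_add_le _ _).trans ?_
  have h2 : ∀ r : ℝ, ‖(r : ℂ)‖ₑ = ‖r‖ₑ := fun r => by
    rw [← ofReal_norm, ← ofReal_norm, Complex.norm_real]
  rw [enorm_mul, h2, h2]
  have h3 : ‖Complex.I‖ₑ = 1 := by rw [← ofReal_norm, Complex.norm_I, ENNReal.ofReal_one]
  rw [h3, mul_one]
  exact add_le_add (SignedMeasure.enorm_le_totalVariation _ _)
    (SignedMeasure.enorm_le_totalVariation _ _)

lemma hasMass_poissonTransformMeasure (hG : IsHomogeneousTree G q) (z : ℂ)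
    (μ : ComplexMeasure (Boundary G o)) :
    HasMass G o (poissonBase q z) (fun x => μ (sector G o x))
      (poissonTransformMeasure G q o z μ) := by
  intro ω' n
  have := isFiniteMeasure_variation μ
  set t := poissonBase q z
  have h1 : kernelPow G q o z (ω' n) = fun ω => (t ^ n)⁻¹ +
      ∑ j ∈ Finset.range n, (sector G o (ω' (j + 1))).indicator
        (fun _ => (t ^ n)⁻¹ * ((t ^ 2 - 1) * (t ^ 2) ^ j)) ω := by
    funext ω
    rw [kernelPow_ray hG.isTree z hG.two_le, mul_add, mul_one, Finset.mul_sum, Finset.mul_sum]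
    congr 1
    refine Finset.sum_congr rfl fun j _ => ?_
    by_cases h : ω ∈ sector G o (ω' (j + 1)) <;> simp [h, t]
  have h2 : ∀ j ∈ Finset.range n, μ.Integrable ((sector G o (ω' (j + 1))).indicator
        (fun _ => (t ^ n)⁻¹ * ((t ^ 2 - 1) * (t ^ 2) ^ j))) := fun j _ =>
    (integrable_const _).indicator (measurableSet_sector _)
  rw [poissonTransformMeasure, h1, VectorMeasure.integral_fun_add]
  · rw [VectorMeasure.integral_const, VectorMeasure.integral_finsetSum _ h2]
    simp_rw [VectorMeasure.integral_indicator_const _ (measurableSet_sector _)]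
    rw [sector_root hG.isTree, mul_add, Finset.mul_sum, Finset.mul_sum]
    simp only [ContinuousLinearMap.mul_apply']
    congr 1
    exact Finset.sum_congr rfl fun j _ => by ring
  · exact integrable_const _
  · exact VectorMeasure.Integrable.fun_finsetSum _ h2

end LocallyFinite

/-! ### Spherical functions -/

/-- The value at distance `n` from `o` of the spherical function with parameter
`T = q ^ (1/2 + i z)`, for real `T`. -/
def sphericalValue (q : ℕ) (T : ℝ) (n : ℕ) : ℝ :=
  (T ^ n)⁻¹ * (1 + (T ^ 2 - 1) / (q + 1) * ∑ j ∈ Finset.range n, (T ^ 2 / q) ^ j)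

lemma sphericalValue_pos {q : ℕ} {T : ℝ} (hT : 1 ≤ T) (n : ℕ) : 0 < sphericalValue q T n := by
  have h1 : 0 ≤ T ^ 2 - 1 := by nlinarith
  have h2 : 0 ≤ ∑ j ∈ Finset.range n, (T ^ 2 / q) ^ j :=
    Finset.sum_nonneg fun j _ => by positivity
  have h3 : 0 < T ^ n := by positivity
  rw [sphericalValue]
  positivity

/-- The symmetry `φ_z = φ_{-z}`: replacing `T` by `q/T` inverts `b = T²/q`, and the geometric sum is
read backwards. It is needed because the weight `φ_{iδ_p}` has parameter `q/T`, whereas the kernel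
with `z = α - iδ_p` has modulus `T`. -/
lemma sphericalValue_div {q : ℕ} (hq : 2 ≤ q) {T : ℝ} (hT : T ≠ 0) (n : ℕ) :
    sphericalValue q (q / T) n = sphericalValue q T n := by
  have hq0 : (q : ℝ) ≠ 0 := by positivity
  have hq1 : (q : ℝ) + 1 ≠ 0 := by positivity
  obtain ⟨b, hb⟩ : ∃ b, T ^ 2 / q = b := ⟨_, rfl⟩
  have hT2 : T ^ 2 = q * b := by rw [← hb]; field_simp
  have hb0 : b ≠ 0 := by
    rintro rfl
    rw [mul_zero] at hT2
    exact hT (pow_eq_zero_iff two_ne_zero |>.1 hT2)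
  have h1 : (q / T) ^ 2 / q = b⁻¹ := by rw [div_pow, hT2]; field_simp
  have h2 : ((q / T) ^ n)⁻¹ = (T ^ n)⁻¹ * b ^ n := by
    rw [← hb, ← inv_pow, ← inv_pow, ← mul_pow]
    congr 1
    field_simp
  have h3 : (q / T) ^ 2 = q * b⁻¹ := by rw [div_pow, hT2]; field_simp
  have h4 : b ^ n * ∑ j ∈ Finset.range n, b⁻¹ ^ j = b * ∑ j ∈ Finset.range n, b ^ j := by
    induction n with
    | zero => simp
    | succ n ih =>
      have h5 : b ^ (n + 1) * b⁻¹ ^ n = b := by rw [pow_succ, inv_pow]; field_simp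
      rw [Finset.sum_range_succ, geom_sum_succ, mul_add, h5]
      linear_combination b * ih (by rw [← hb, ← inv_pow, ← inv_pow, ← mul_pow]; congr 1; field_simp)
  have h5 := mul_geom_sum b n
  rw [sphericalValue, sphericalValue, h1, h2, h3, hb, hT2, mul_assoc]
  congr 1
  have h6 : b ^ n * ((q * b⁻¹ - 1) / (q + 1) * ∑ j ∈ Finset.range n, b⁻¹ ^ j) =
      (q - b) / (q + 1) * ∑ j ∈ Finset.range n, b ^ j := by
    rw [mul_left_comm, h4]
    field_simp
  rw [mul_add, h6, mul_one]
  field_simp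
  linear_combination (-(q : ℝ) - 1) * h5

lemma cast_sphereCard_succ {K : Type*} [Semiring K] (q n : ℕ) :
    (sphereCard q (n + 1) : K) = (q + 1) * q ^ n := by
  simp [sphereCard]

section LocallyFinite

variable [G.LocallyFinite] {q : ℕ}

lemma spherical_ray (hG : IsHomogeneousTree G q) (z : ℂ) {T : ℝ} (hT : poissonBase q z = T)
    (ω : Boundary G o) (n : ℕ) : spherical G q o z (ω n) = (sphericalValue q T n : ℝ) := by
  have := isProbabilityMeasure_boundaryMeasure (o := o) hG
  have hq0 : (q : ℂ) ≠ 0 := by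
    have := hG.two_le
    exact_mod_cast (by omega : q ≠ 0)
  have hq1 : (q : ℂ) + 1 ≠ 0 := by exact_mod_cast Nat.succ_ne_zero q
  rw [spherical, hasMass_poissonTransform hG z (integrable_const 1), hT]
  simp only [setIntegral_const, boundaryMeasure_real_sector hG, ω.dist', SimpleGraph.dist_self]
  rw [sphericalValue]
  push_cast
  rw [Finset.mul_sum, Finset.mul_sum]
  congr 2
  · simp [sphereCard]
  · refine Finset.sum_congr rfl fun j _ => ?_
    simp only [Complex.real_smul]
    push_cast
    rw [cast_sphereCard_succ (K := ℂ), div_pow]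
    field_simp

/-! ### The Hardy norm as a supremum of `L^r` norms on the boundary -/

/-- For finite `r` the sphere mean is an integral over the boundary. For `r = ∞` the essential
supremum loses nothing, since every sector has positive measure. -/
lemma hardyNorm_eq (hG : IsHomogeneousTree G q) (ω₀ : Boundary G o) {p : ℝ} {T : ℝ} (hT : 1 ≤ T)
    (h : poissonBase q (Complex.I * (delta p : ℂ)) = ((q / T : ℝ) : ℂ)) {r : ℝ≥0∞} (hr : r ≠ 0)
    (u : V → ℂ) :
    hardyNorm G q o ω₀ p r u = ⨆ n : ℕ, (ENNReal.ofReal (sphericalValue q T n))⁻¹ *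
      eLpNorm (fun ω : Boundary G o => u (ω n)) r (boundaryMeasure G o) := by
  have hφ : ∀ (ω : Boundary G o) (n : ℕ), ‖spherical G q o (Complex.I * (delta p : ℂ)) (ω n)‖ₑ =
      ENNReal.ofReal (sphericalValue q T n) := by
    intro ω n
    rw [spherical_ray hG _ h, sphericalValue_div hG.two_le (by positivity), ← ofReal_norm,
      Complex.norm_real, Real.norm_of_nonneg (sphericalValue_pos hT n).le]
  have hφ0 : ∀ n, ENNReal.ofReal (sphericalValue q T n) ≠ 0 := fun n =>
    (ENNReal.ofReal_pos.2 (sphericalValue_pos hT n)).ne'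
  rw [hardyNorm]
  split_ifs with hr'
  · subst hr'
    simp only [eLpNorm_exponent_top]
    refine le_antisymm (iSup_le fun x => ?_) (iSup_le fun n => ?_)
    · obtain ⟨ω, hω⟩ := exists_ray (o := o) hG x
      refine le_trans ?_ (le_iSup _ (G.dist o x))
      rw [← hφ ω, hω]
      gcongr
      have h1 := ae_le_eLpNormEssSup (f := fun ω : Boundary G o => u (ω (G.dist o x)))
        (μ := boundaryMeasure G o)
      by_contra hlt
      -- A violation at `x` would occur on the whole sector of `x`.
      have h2 : boundaryMeasure G o (sector G o x) = 0 := by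
        refine measure_mono_null (fun ω' hω' => ?_) h1
        rw [mem_sector hG.isTree.connected] at hω'
        simpa [hω'] using hlt
      rw [boundaryMeasure_sector hG, ENNReal.inv_eq_zero] at h2
      exact ENNReal.natCast_ne_top _ h2
    · rw [mul_comm, ← div_eq_mul_inv, ENNReal.div_le_iff (hφ0 n) ENNReal.ofReal_ne_top]
      refine essSup_le_of_ae_le _ (Filter.Eventually.of_forall fun ω => ?_)
      simp only
      rw [← ENNReal.div_le_iff (hφ0 n) ENNReal.ofReal_ne_top, div_eq_mul_inv, mul_comm, ← hφ ω]
      exact le_iSup (fun x => ‖spherical G q o (Complex.I * (delta p : ℂ)) x‖ₑ⁻¹ * ‖u x‖ₑ) (ω n)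
  · refine iSup_congr fun n => ?_
    rw [hφ, sphereAverage_eq_lintegral hG, eLpNorm_eq_lintegral_rpow_enorm_toReal hr hr']

lemma hardyNorm_le_iff (hG : IsHomogeneousTree G q) (ω₀ : Boundary G o) {p : ℝ} {T : ℝ}
    (hT : 1 ≤ T) (h : poissonBase q (Complex.I * (delta p : ℂ)) = ((q / T : ℝ) : ℂ)) {r : ℝ≥0∞}
    (hr : r ≠ 0) (u : V → ℂ) {N : ℝ≥0∞} :
    hardyNorm G q o ω₀ p r u ≤ N ↔
      ∀ n, eLpNorm (fun ω : Boundary G o => u (ω n)) r (boundaryMeasure G o) ≤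
        ENNReal.ofReal (sphericalValue q T n) * N := by
  rw [hardyNorm_eq hG ω₀ hT h hr, iSup_le_iff]
  refine forall_congr' fun n => ?_
  have hφ0 : ENNReal.ofReal (sphericalValue q T n) ≠ 0 :=
    (ENNReal.ofReal_pos.2 (sphericalValue_pos hT n)).ne'
  rw [mul_comm, ← div_eq_mul_inv, ENNReal.div_le_iff hφ0 ENNReal.ofReal_ne_top, mul_comm]

/-! ### Densities of mass functions -/

variable (G o) in
/-- The density, with respect to `ν`, on the `n`-th `σ`-algebra of the set function which has the
value `v x` on `E(x)`. -/
def massDensity (q : ℕ) (v : V → ℂ) (n : ℕ) (ω : Boundary G o) : ℂ :=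
  sphereCard q n * v (ω n)

lemma massDensity_condExp (hG : IsHomogeneousTree G q) {F : Boundary G o → ℂ}
    (hF : Integrable F (boundaryMeasure G o)) (n : ℕ) :
    massDensity G o q (fun x => ∫ ω in sector G o x, F ω ∂(boundaryMeasure G o)) n
      =ᵐ[boundaryMeasure G o] (boundaryMeasure G o)[F | rayFiltration hG.isTree o n] := by
  refine eval_ae_eq_condExp (f := fun x => (sphereCard q n : ℂ) *
    ∫ ω in sector G o x, F ω ∂(boundaryMeasure G o)) hG hF fun x _ => ?_
  have := (sphereCard_pos hG.two_le n).ne'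
  rw [Complex.real_smul]
  push_cast
  rw [inv_mul_cancel_left₀ (by exact_mod_cast this)]

/-- The integral of the density of level `n + 1` over the sector of `x` is the sum of the masses of
the children of `x`, which additivity identifies with `v x`. -/
lemma martingale_massDensity (hG : IsHomogeneousTree G q) {v : V → ℂ} (hv : IsFlow G o v) :
    Martingale (massDensity G o q v) (rayFiltration hG.isTree o) (boundaryMeasure G o) := by
  have := isProbabilityMeasure_boundaryMeasure (o := o) hG
  refine martingale_nat (fun n => stronglyMeasurable_eval hG.isTree n fun x =>
    (sphereCard q n : ℂ) * v x) (fun n => integrable_eval hG n fun x =>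
    (sphereCard q n : ℂ) * v x) fun n => ?_
  refine eval_ae_eq_condExp (f := fun x => (sphereCard q n : ℂ) * v x) hG
    (integrable_eval hG (n + 1) fun x => (sphereCard q (n + 1) : ℂ) * v x) fun x hx => ?_
  have h1 := (sphereCard_pos hG.two_le n).ne'
  have h2 := (sphereCard_pos hG.two_le (n + 1)).ne'
  have h3 : ∀ y ∈ childFinset G o x, ∫ ω in sector G o y, massDensity G o q v (n + 1) ω
      ∂(boundaryMeasure G o) = v y := by
    intro y hy
    rw [mem_childFinset, hx] at hy
    have := setIntegral_sector_eval hG hy.2 fun x => (sphereCard q (n + 1) : ℂ) * v x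
    simp only [massDensity]
    rw [this, Complex.real_smul]
    push_cast
    rw [inv_mul_cancel_left₀ (by exact_mod_cast h2)]
  have h4 := isFlow_setIntegral (μ := boundaryMeasure G o) hG.isTree
    (integrable_eval hG (n + 1) fun x => (sphereCard q (n + 1) : ℂ) * v x) x
  refine (h4.trans (Finset.sum_congr rfl h3)).trans ?_
  rw [← hv x, Complex.real_smul]
  push_cast
  rw [inv_mul_cancel_left₀ (by exact_mod_cast h1)]

/-- The mass at `ω (j + 1)` is its density divided by `(q + 1) q^j`, which turns the ratio `t²` into
`t²/q`. -/
lemma HasMass.eq_sum_massDensity (hG : IsHomogeneousTree G q) {t : ℂ} {v u : V → ℂ}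
    (h : HasMass G o t v u) (ω : Boundary G o) (n : ℕ) :
    u (ω n) = (t ^ n)⁻¹ * (massDensity G o q v 0 ω + (t ^ 2 - 1) / (q + 1) *
      ∑ j ∈ Finset.range n, (t ^ 2 / q) ^ j * massDensity G o q v (j + 1) ω) := by
  have hq0 : (q : ℂ) ≠ 0 := by
    have := hG.two_le
    exact_mod_cast (by omega : q ≠ 0)
  have hq1 : (q : ℂ) + 1 ≠ 0 := by exact_mod_cast Nat.succ_ne_zero q
  rw [h ω n, Finset.mul_sum, Finset.mul_sum]
  congr 2
  · simp [massDensity, sphereCard, ω.map_zero']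
  · refine Finset.sum_congr rfl fun j _ => ?_
    rw [massDensity, cast_sphereCard_succ (K := ℂ), div_pow]
    field_simp

/-- Minkowski's inequality. When `t ≥ 1` is real the factor is exactly the spherical function; for
complex `t` the term `‖t² - 1‖` may exceed `‖t‖² - 1`, and a constant is lost. -/
lemma HasMass.eLpNorm_le (hG : IsHomogeneousTree G q) {t : ℂ} {v u : V → ℂ}
    (h : HasMass G o t v u) {r : ℝ≥0∞} (hr : 1 ≤ r) {K : ℝ≥0∞}
    (hK : ∀ n, eLpNorm (massDensity G o q v n) r (boundaryMeasure G o) ≤ K) (n : ℕ) :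
    eLpNorm (fun ω : Boundary G o => u (ω n)) r (boundaryMeasure G o) ≤
      ENNReal.ofReal ((‖t‖ ^ n)⁻¹ * (1 + ‖t ^ 2 - 1‖ / (q + 1) *
        ∑ j ∈ Finset.range n, (‖t‖ ^ 2 / q) ^ j)) * K := by
  have hm : ∀ j, AEStronglyMeasurable (massDensity G o q v j) (boundaryMeasure G o) := fun j =>
    (stronglyMeasurable_eval' hG.isTree j fun x => (sphereCard q j : ℂ) * v x).aestronglyMeasurable
  have h0 : (fun ω : Boundary G o => u (ω n)) = (t ^ n)⁻¹ • (massDensity G o q v 0 +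
      ((t ^ 2 - 1) / (q + 1) : ℂ) •
        ∑ j ∈ Finset.range n, ((t ^ 2 / q) ^ j : ℂ) • massDensity G o q v (j + 1)) := by
    funext ω
    rw [h.eq_sum_massDensity hG]
    simp [Finset.sum_apply]
  have hn : ∀ c : ℂ, ‖c‖ₑ = ENNReal.ofReal ‖c‖ := fun c => (ofReal_norm c).symm
  have hS : 0 ≤ ∑ j ∈ Finset.range n, (‖t‖ ^ 2 / q) ^ j :=
    Finset.sum_nonneg fun j _ => by positivity
  have hq1 : ‖(q : ℂ) + 1‖ = q + 1 := by
    have : ((q : ℂ) + 1) = ((q + 1 : ℕ) : ℂ) := by push_cast; rfl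
    rw [this, Complex.norm_natCast]; push_cast; rfl
  rw [h0, eLpNorm_const_smul, hn, norm_inv, norm_pow, ENNReal.ofReal_mul (by positivity), mul_assoc]
  gcongr
  refine (eLpNorm_add_le (hm 0) ?_ hr).trans ?_
  · exact (Finset.aestronglyMeasurable_sum _ fun j _ => (hm _).const_smul _).const_smul _
  rw [ENNReal.ofReal_add zero_le_one (by positivity), ENNReal.ofReal_one, add_mul, one_mul]
  refine add_le_add (hK 0) ?_
  rw [eLpNorm_const_smul, hn, norm_div, hq1, ENNReal.ofReal_mul (by positivity), mul_assoc]
  gcongr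
  refine (eLpNorm_sum_le (fun j _ => (hm _).const_smul _) hr).trans ?_
  rw [ENNReal.ofReal_sum_of_nonneg fun j _ => by positivity, Finset.sum_mul]
  refine Finset.sum_le_sum fun j _ => ?_
  rw [eLpNorm_const_smul, hn, norm_pow, norm_div, norm_pow, Complex.norm_natCast]
  gcongr
  exact hK _

lemma eLpNorm_massDensity_le (hG : IsHomogeneousTree G q) {F : Boundary G o → ℂ}
    (hF : Integrable F (boundaryMeasure G o)) {r : ℝ≥0∞} (hr : 1 ≤ r) (n : ℕ) :
    eLpNorm (massDensity G o q (fun x => ∫ ω in sector G o x, F ω ∂(boundaryMeasure G o)) n) r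
      (boundaryMeasure G o) ≤ eLpNorm F r (boundaryMeasure G o) := by
  have := isProbabilityMeasure_boundaryMeasure (o := o) hG
  rw [eLpNorm_congr_ae (massDensity_condExp hG hF n)]
  exact eLpNorm_condExp_le_eLpNorm F hr

end LocallyFinite

/-! ### Parameters -/

lemma poissonBase_real (q : ℕ) (s : ℝ) :
    poissonBase q (Complex.I * (s : ℂ)) = (((q : ℝ) ^ (1 / 2 - s) : ℝ) : ℂ) := by
  rw [poissonBase, Complex.ofReal_cpow (Nat.cast_nonneg q), Complex.ofReal_natCast]
  congr 1
  push_cast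
  linear_combination (s : ℂ) * Complex.I_mul_I

lemma poissonBase_delta {q : ℕ} (hq : 2 ≤ q) (p : ℝ) :
    poissonBase q (Complex.I * (delta p : ℂ)) = ((q / (q : ℝ) ^ (1 / p) : ℝ) : ℂ) := by
  have hq0 : (0 : ℝ) < q := by positivity
  rw [poissonBase_real, delta, show (1 / 2 - (1 / p - 1 / 2) : ℝ) = 1 - 1 / p by ring,
    Real.rpow_sub hq0, Real.rpow_one]

lemma norm_poissonBase {q : ℕ} (hq : 2 ≤ q) (z : ℂ) :
    ‖poissonBase q z‖ = (q : ℝ) ^ (1 / 2 - z.im) := by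
  rw [poissonBase, Complex.norm_natCast_cpow_of_pos (by omega)]
  congr 1
  simp
  ring

/-! ### Upper bound for the Poisson transform of a function -/

lemma poissonKernel_pos {q : ℕ} (hq : 2 ≤ q) (x : V) (ω : Boundary G o) : 0 < poissonKernel G q o x ω := by
  have : (0 : ℝ) < q := by positivity
  exact zpow_pos this _

/-- The modulus of `p^(1/2+iz)` is `p^(1/2 - Im z)`. Passing to this positive kernel first is what
gives the upper bound with constant one. -/
lemma enorm_poissonTransform_le {q : ℕ} (hq : 2 ≤ q) (z : ℂ) (F : Boundary G o → ℂ) (x : V) :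
    ‖poissonTransform G q o z F x‖ₑ ≤
      ‖poissonTransform G q o (Complex.I * (z.im : ℂ)) (fun ω => (‖F ω‖ : ℂ)) x‖ₑ := by
  have h1 : ∀ ω, kernelPow G q o (Complex.I * (z.im : ℂ)) x ω * (‖F ω‖ : ℂ) =
      ((‖kernelPow G q o z x ω * F ω‖ : ℝ) : ℂ) := by
    intro ω
    have hp := poissonKernel_pos (o := o) hq x ω
    rw [norm_mul, kernelPow, kernelPow, Complex.norm_cpow_eq_rpow_re_of_pos hp,
      Complex.ofReal_mul, Complex.ofReal_cpow hp.le]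
    congr 2
    have : (1 / 2 + Complex.I * z).re = 1 / 2 - z.im := by simp; ring
    rw [this]
    push_cast
    linear_combination (z.im : ℂ) * Complex.I_mul_I
  rw [poissonTransform, poissonTransform]
  simp_rw [h1]
  rw [integral_complex_ofReal, ← ofReal_norm, ← ofReal_norm, Complex.norm_real, Real.norm_of_nonneg
    (integral_nonneg fun ω => norm_nonneg _)]
  exact ENNReal.ofReal_le_ofReal (norm_integral_le_integral_norm _)

section LocallyFinite

variable [G.LocallyFinite] {q : ℕ}

lemma eLpNorm_poissonTransform_le (hG : IsHomogeneousTree G q) (z : ℂ) {T : ℝ}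
    (hT : ‖poissonBase q z‖ = T) (hT1 : 1 ≤ T) {r : ℝ≥0∞}
    (hr : 1 ≤ r) {F : Boundary G o → ℂ} (hF : Integrable F (boundaryMeasure G o)) (n : ℕ) :
    eLpNorm (fun ω : Boundary G o => poissonTransform G q o z F (ω n)) r (boundaryMeasure G o) ≤
      ENNReal.ofReal (sphericalValue q T n) * eLpNorm F r (boundaryMeasure G o) := by
  have hF' : Integrable (fun ω => (‖F ω‖ : ℂ)) (boundaryMeasure G o) := hF.norm.ofReal
  have hT' : poissonBase q (Complex.I * (z.im : ℂ)) = (T : ℂ) := by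
    rw [poissonBase_real, ← hT, norm_poissonBase hG.two_le]
  have h1 := (hasMass_poissonTransform hG (Complex.I * (z.im : ℂ)) hF').eLpNorm_le hG hr
    (eLpNorm_massDensity_le hG hF' hr) n
  have h2 : eLpNorm (fun ω => (‖F ω‖ : ℂ)) r (boundaryMeasure G o) =
      eLpNorm F r (boundaryMeasure G o) :=
    eLpNorm_congr_norm_ae (Filter.Eventually.of_forall fun ω => by simp)
  have h3 : ‖(T : ℂ) ^ 2 - 1‖ = T ^ 2 - 1 := by
    have : (T : ℂ) ^ 2 - 1 = ((T ^ 2 - 1 : ℝ) : ℂ) := by push_cast; rfl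
    rw [this, Complex.norm_real, Real.norm_of_nonneg (by nlinarith)]
  rw [hT', h2, h3, Complex.norm_real, Real.norm_of_nonneg (by linarith)] at h1
  refine le_trans (eLpNorm_mono_enorm fun ω => ?_) h1
  exact enorm_poissonTransform_le hG.two_le z F _

/-! ### Lower bound -/

/-- Terms with `j < k` are already known at level `k`; for `j ≥ k` the martingale property replaces
`M_{j+1}` by `M_k`. -/
lemma condExp_sum_massDensity (hG : IsHomogeneousTree G q) {v : V → ℂ} (hv : IsFlow G o v)
    (c : ℂ) (β : ℂ) {k n : ℕ} (hkn : k ≤ n) :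
    (boundaryMeasure G o)[massDensity G o q v 0 + c • ∑ j ∈ Finset.range n,
        β ^ j • massDensity G o q v (j + 1) | rayFiltration hG.isTree o k]
      =ᵐ[boundaryMeasure G o] massDensity G o q v 0 + c • ∑ j ∈ Finset.range k,
        β ^ j • massDensity G o q v (j + 1) +
        (c * ∑ j ∈ Finset.Ico k n, β ^ j) • massDensity G o q v k := by
  have := isProbabilityMeasure_boundaryMeasure (o := o) hG
  have hM := martingale_massDensity hG hv
  have hint : ∀ n, Integrable (massDensity G o q v 0 + c • ∑ j ∈ Finset.range n,
      β ^ j • massDensity G o q v (j + 1)) (boundaryMeasure G o) := fun n =>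
    (hM.integrable 0).add ((integrable_finsetSum' _ fun j _ => (hM.integrable _).smul _).smul _)
  induction n, hkn using Nat.le_induction with
  | base =>
    rw [Finset.Ico_self, Finset.sum_empty, mul_zero, zero_smul, add_zero]
    rw [condExp_of_stronglyMeasurable ((rayFiltration hG.isTree o).le k) ?_ (hint k)]
    refine ((hM.stronglyMeasurable 0).mono ((rayFiltration hG.isTree o).mono (Nat.zero_le k))).add
      (StronglyMeasurable.const_smul (Finset.stronglyMeasurable_sum _ fun j hj => ?_) _)
    exact ((hM.stronglyMeasurable _).mono ((rayFiltration hG.isTree o).mono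
      (Finset.mem_range.1 hj))).const_smul _
  | succ n hn ih =>
    have h1 : massDensity G o q v 0 + c • ∑ j ∈ Finset.range (n + 1),
        β ^ j • massDensity G o q v (j + 1) = (massDensity G o q v 0 + c • ∑ j ∈ Finset.range n,
        β ^ j • massDensity G o q v (j + 1)) + (c * β ^ n) • massDensity G o q v (n + 1) := by
      rw [Finset.sum_range_succ, smul_add, add_assoc, smul_smul]
    rw [h1]
    refine (condExp_add (hint n) ((hM.integrable (n + 1)).smul _) _).trans ?_
    filter_upwards [ih, condExp_smul (c * β ^ n) (massDensity G o q v (n + 1))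
      (rayFiltration hG.isTree o k) (μ := boundaryMeasure G o), hM.2 k (n + 1) (by omega)]
      with ω h2 h3 h4
    rw [Pi.add_apply, h2, h3, Finset.sum_Ico_succ_top hn]
    simp only [Pi.add_apply, Pi.smul_apply, smul_eq_mul, h4]
    ring

/-- The norm of the `k`-th density is controlled by the norms of the transform on the spheres of
radius `k` and `n ≥ k`. -/
lemma HasMass.mul_eLpNorm_massDensity_le (hG : IsHomogeneousTree G q) {t : ℂ} (ht : t ≠ 0)
    {v u : V → ℂ} (h : HasMass G o t v u) (hv : IsFlow G o v) {r : ℝ≥0∞} (hr : 1 ≤ r)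
    {k n : ℕ} (hkn : k ≤ n) :
    ‖(t ^ 2 - 1) / (q + 1) * ∑ j ∈ Finset.Ico k n, (t ^ 2 / q) ^ j‖ₑ *
        eLpNorm (massDensity G o q v k) r (boundaryMeasure G o) ≤
      ‖t ^ n‖ₑ * eLpNorm (fun ω : Boundary G o => u (ω n)) r (boundaryMeasure G o) +
        ‖t ^ k‖ₑ * eLpNorm (fun ω : Boundary G o => u (ω k)) r (boundaryMeasure G o) := by
  have := isProbabilityMeasure_boundaryMeasure (o := o) hG
  set c : ℂ := (t ^ 2 - 1) / (q + 1)
  set β : ℂ := t ^ 2 / q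
  -- Multiplying by `t^n` turns the values of `u` into partial sums of one series, so that only the
  -- increments between `k` and `n` survive conditioning.
  have hW : ∀ n, massDensity G o q v 0 + c • ∑ j ∈ Finset.range n,
      β ^ j • massDensity G o q v (j + 1) = t ^ n • fun ω : Boundary G o => u (ω n) := by
    intro n
    funext ω
    simp only [Pi.smul_apply, smul_eq_mul]
    rw [h.eq_sum_massDensity hG, mul_inv_cancel_left₀ (pow_ne_zero n ht)]
    simp [Finset.sum_apply, c, β]
  have h1 := condExp_sum_massDensity hG hv c β hkn
  rw [hW, hW] at h1
  rw [← eLpNorm_const_smul, ← eLpNorm_const_smul, ← eLpNorm_const_smul]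
  have h2 : (c * ∑ j ∈ Finset.Ico k n, β ^ j) • massDensity G o q v k =ᵐ[boundaryMeasure G o]
      (boundaryMeasure G o)[t ^ n • fun ω : Boundary G o => u (ω n) |
        rayFiltration hG.isTree o k] - t ^ k • fun ω : Boundary G o => u (ω k) := by
    filter_upwards [h1] with ω h1
    rw [Pi.sub_apply, h1, Pi.add_apply, add_sub_cancel_left]
  rw [eLpNorm_congr_ae h2]
  refine (eLpNorm_sub_le ?_ ?_ hr).trans (add_le_add_left (eLpNorm_condExp_le_eLpNorm _ hr) _)
  · exact (stronglyMeasurable_condExp.mono ((rayFiltration hG.isTree o).le k)).aestronglyMeasurable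
  · exact ((stronglyMeasurable_eval' hG.isTree k u).const_smul _).aestronglyMeasurable

end LocallyFinite

/-! ### The constant obtained as the radius tends to infinity -/

lemma mul_le_mul_of_tendsto_atTop {x : ℕ → ℝ} (hx : Filter.Tendsto x Filter.atTop Filter.atTop)
    {A B m N e : ℝ} {k : ℕ} (h : ∀ n ≥ k, A * x n * m ≤ B * x n * N + e) : A * m ≤ B * N := by
  by_contra! hlt
  have h1 := (hx.const_mul_atTop (sub_pos.2 hlt)).eventually_gt_atTop e
  obtain ⟨n, hn, hnk⟩ := (h1.and (Filter.eventually_ge_atTop k)).exists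
  have := h n hnk
  nlinarith

/-- The constant in the lower bound for the Poisson transform. -/
def lowerConst (p : ℝ) : ℝ :=
  if p = 2 then 1 else ((2 : ℝ) ^ (2 / p - 1) - 1) / ((2 : ℝ) ^ (2 / p - 1) + 1)

lemma lowerConst_pos {p : ℝ} (hp1 : 1 ≤ p) (hp2 : p ≤ 2) : 0 < lowerConst p := by
  rw [lowerConst]
  split_ifs with h
  · exact one_pos
  · have h1 : p < 2 := lt_of_le_of_ne hp2 h
    have h2 : 0 < 2 / p - 1 := by
      rw [sub_pos, lt_div_iff₀ (by linarith)]; linarith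
    have h3 := Real.one_lt_rpow (one_lt_two (α := ℝ)) h2
    exact div_pos (by linarith) (by linarith)

/-- Numerical form of the lower bound. -/
lemma lowerConst_mul_le {p : ℝ} (hp1 : 1 ≤ p) (hp2 : p ≤ 2) {q : ℕ} (hq : 2 ≤ q) {t : ℂ}
    (ht : ‖t‖ = (q : ℝ) ^ (1 / p)) (ht2 : p = 2 → t ^ 2 = q) {k : ℕ} {m N : ℝ} (hm : 0 ≤ m)
    (hN : 0 ≤ N)
    (h : ∀ n ≥ k, ‖(t ^ 2 - 1) / (q + 1) * ∑ j ∈ Finset.Ico k n, (t ^ 2 / q) ^ j‖ * m ≤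
      ((1 + (‖t‖ ^ 2 - 1) / (q + 1) * ∑ j ∈ Finset.range n, (‖t‖ ^ 2 / q) ^ j) +
      (1 + (‖t‖ ^ 2 - 1) / (q + 1) * ∑ j ∈ Finset.range k, (‖t‖ ^ 2 / q) ^ j)) * N) :
    lowerConst p * m ≤ N := by
  have hq0 : (0 : ℝ) < q := by positivity
  have hq2 : (2 : ℝ) ≤ q := by exact_mod_cast hq
  have hq0' : (q : ℂ) ≠ 0 := by exact_mod_cast hq0.ne'
  have hq1 : ‖(q : ℂ) + 1‖ = q + 1 := by
    have : ((q : ℂ) + 1) = ((q + 1 : ℕ) : ℂ) := by push_cast; rfl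
    rw [this, Complex.norm_natCast]; push_cast; rfl
  set e := 1 + (‖t‖ ^ 2 - 1) / (q + 1) * ∑ j ∈ Finset.range k, (‖t‖ ^ 2 / q) ^ j with he
  have hT2 : ‖t‖ ^ 2 / q = (q : ℝ) ^ (2 / p - 1) := by
    rw [ht, ← Real.rpow_natCast, ← Real.rpow_mul hq0.le, Real.rpow_sub hq0, Real.rpow_one]
    congr 2
    push_cast
    ring
  rw [lowerConst]
  split_ifs with hp
  · have h1 : t ^ 2 / q = 1 := by rw [ht2 hp, div_self hq0']
    have h2 : ‖t‖ ^ 2 = q := by rw [← norm_pow, ht2 hp, Complex.norm_natCast]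
    have h3 : ‖(t ^ 2 - 1) / ((q : ℂ) + 1)‖ = (q - 1) / (q + 1) := by
      rw [norm_div, hq1, ht2 hp]
      congr 1
      have : ((q : ℂ) - 1) = (((q : ℝ) - 1 : ℝ) : ℂ) := by push_cast; rfl
      rw [this, Complex.norm_real, Real.norm_of_nonneg (by linarith)]
    simp only [norm_mul, h1, h3, h2, div_self hq0.ne', one_pow, Finset.sum_const, Nat.card_Ico,
      Finset.card_range, nsmul_eq_mul, mul_one, Complex.norm_natCast] at h
    have hc : 0 < ((q : ℝ) - 1) / (q + 1) := div_pos (by linarith) (by linarith)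
    generalize ((q : ℝ) - 1) / (q + 1) = c at h hc
    -- For `p = 2` both sides are linear in `n` with the same slope factor `c`, which gives the
    -- constant one.
    have h4 : c * m ≤ c * N := by
      refine mul_le_mul_of_tendsto_atTop (x := fun n : ℕ => (n : ℝ)) tendsto_natCast_atTop_atTop
        (k := k) (e := (1 + e) * N + c * k * m) fun n hn => ?_
      have := h n hn
      rw [Nat.cast_sub hn] at this
      linarith
    rw [one_mul]
    exact le_of_mul_le_mul_left h4 hc
  · have h1 : p < 2 := lt_of_le_of_ne hp2 hp
    have h2 : 0 < 2 / p - 1 := by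
      rw [sub_pos, lt_div_iff₀ (by linarith)]; linarith
    have ha := Real.one_lt_rpow (one_lt_two (α := ℝ)) h2
    have hab : (2 : ℝ) ^ (2 / p - 1) ≤ (q : ℝ) ^ (2 / p - 1) :=
      Real.rpow_le_rpow (by norm_num) hq2 h2.le
    set a := (2 : ℝ) ^ (2 / p - 1)
    obtain ⟨b, hb⟩ : ∃ b, (q : ℝ) ^ (2 / p - 1) = b := ⟨_, rfl⟩
    rw [hb] at hab hT2
    have hb1 : 1 < b := by linarith
    have hβ : ‖t ^ 2 / (q : ℂ)‖ = b := by rw [norm_div, norm_pow, Complex.norm_natCast, hT2]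
    set β := t ^ 2 / (q : ℂ)
    have hT : ‖t‖ ^ 2 = q * b := by rw [← hT2]; field_simp
    set c := (‖t‖ ^ 2 - 1) / ((q : ℝ) + 1) with hc'
    have hc : 0 < c := by
      refine div_pos ?_ (by linarith)
      rw [hT]; nlinarith
    have hcle : c ≤ ‖(t ^ 2 - 1) / ((q : ℂ) + 1)‖ := by
      rw [norm_div, hq1, hc']
      gcongr
      have := norm_sub_norm_le (t ^ 2) 1
      rwa [norm_pow, norm_one] at this
    -- Both sides grow like `b^n`; everything independent of `n` is collected in `e` and disappears
    -- in the limit.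
    have h3 : c / (b + 1) * m ≤ c / (b - 1) * N := by
      refine mul_le_mul_of_tendsto_atTop (x := fun n : ℕ => b ^ n)
        (tendsto_pow_atTop_atTop_of_one_lt hb1)
        (k := k) (e := (1 + e) * N + c / (b + 1) * b ^ k * m) fun n hn => ?_
      have h4 := h n hn
      have h5 : (b ^ n - b ^ k) / (b + 1) ≤ ‖∑ j ∈ Finset.Ico k n, β ^ j‖ := by
        rw [div_le_iff₀ (by linarith)]
        have h6 : (∑ j ∈ Finset.Ico k n, β ^ j) * (β - 1) = β ^ n - β ^ k := geom_sum_Ico_mul β hn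
        have h7 := norm_sub_norm_le (β ^ n) (β ^ k)
        rw [← h6, norm_mul, norm_pow, norm_pow, hβ] at h7
        have h8 : ‖β - 1‖ ≤ b + 1 := by
          have := norm_sub_le β 1
          rwa [hβ, norm_one] at this
        exact h7.trans (mul_le_mul_of_nonneg_left h8 (norm_nonneg _))
      have h6 : ∑ j ∈ Finset.range n, (‖t‖ ^ 2 / q) ^ j ≤ b ^ n / (b - 1) := by
        rw [hT2, le_div_iff₀ (by linarith), geom_sum_mul]
        linarith
      have h7 : c * ((b ^ n - b ^ k) / (b + 1)) * m ≤
          ‖(t ^ 2 - 1) / ((q : ℂ) + 1) * ∑ j ∈ Finset.Ico k n, β ^ j‖ * m := by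
        rw [norm_mul]
        have : 0 ≤ (b ^ n - b ^ k) / (b + 1) :=
          div_nonneg (sub_nonneg.2 (pow_le_pow_right₀ hb1.le hn)) (by linarith)
        gcongr
      have h8 := (h7.trans h4).trans (mul_le_mul_of_nonneg_right
        (add_le_add_left (add_le_add_right (mul_le_mul_of_nonneg_left h6 hc.le) 1) e) hN)
      have e1 : c * ((b ^ n - b ^ k) / (b + 1)) * m =
        c / (b + 1) * b ^ n * m - c / (b + 1) * b ^ k * m := by ring
      have e2 : (1 + c * (b ^ n / (b - 1)) + e) * N = c / (b - 1) * b ^ n * N + (1 + e) * N := by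
        ring
      linarith
    have h4 : (b - 1) * m ≤ (b + 1) * N := by
      clear_value c
      rw [div_mul_eq_mul_div, div_mul_eq_mul_div, div_le_div_iff₀ (by linarith) (by linarith)] at h3
      refine le_of_mul_le_mul_left (a := c) ?_ hc
      linarith
    rw [div_mul_eq_mul_div, div_le_iff₀ (by linarith)]
    -- The function `s ↦ (s - 1)/(s + 1)` is increasing and `a ≤ b`, so replacing `q` by `2` makes
    -- the constant independent of `q`.
    have h5 : (a - 1) * (b + 1) ≤ (b - 1) * (a + 1) := by nlinarith
    have h6 : ((a - 1) * m) * (b + 1) ≤ (N * (a + 1)) * (b + 1) := by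
      calc ((a - 1) * m) * (b + 1) = ((a - 1) * (b + 1)) * m := by ring
        _ ≤ ((b - 1) * (a + 1)) * m := mul_le_mul_of_nonneg_right h5 hm
        _ = ((b - 1) * m) * (a + 1) := by ring
        _ ≤ ((b + 1) * N) * (a + 1) := mul_le_mul_of_nonneg_right h4 (by linarith)
        _ = _ := by ring
    exact le_of_mul_le_mul_right h6 (by linarith)

section LocallyFinite

variable [G.LocallyFinite] {q : ℕ}

/-- The conditional expectation estimate for all `n ≥ k`, combined with the growth comparison. The
resulting bound is uniform in `k`, which both the lower estimate and the existence of boundary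
values need. -/
lemma HasMass.eLpNorm_massDensity_le (hG : IsHomogeneousTree G q) {p : ℝ} (hp1 : 1 ≤ p)
    (hp2 : p ≤ 2) {t : ℂ} (ht : ‖t‖ = (q : ℝ) ^ (1 / p)) (ht2 : p = 2 → t ^ 2 = q)
    {v u : V → ℂ} (h : HasMass G o t v u) (hv : IsFlow G o v) {r : ℝ≥0∞} (hr : 1 ≤ r) {N : ℝ≥0∞}
    (hN : ∀ n, eLpNorm (fun ω : Boundary G o => u (ω n)) r (boundaryMeasure G o) ≤
      ENNReal.ofReal (sphericalValue q ‖t‖ n) * N) (k : ℕ) :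
    ENNReal.ofReal (lowerConst p) * eLpNorm (massDensity G o q v k) r (boundaryMeasure G o)
      ≤ N := by
  have hprob := isProbabilityMeasure_boundaryMeasure (o := o) hG
  have hq2 : (2 : ℝ) ≤ q := by exact_mod_cast hG.two_le
  have hT1 : 1 ≤ ‖t‖ := by
    rw [ht]; exact Real.one_le_rpow (by linarith) (by positivity)
  have ht0 : t ≠ 0 := norm_pos_iff.1 (by linarith)
  rcases eq_or_ne N ∞ with rfl | hNtop
  · exact le_top
  -- A density takes finitely many values, so its norm is finite and the inequality can be treated
  -- with real numbers.
  obtain ⟨C, hC⟩ : ∃ C : ℝ, ∀ x ∈ sphereFinset hG.isTree o k, ‖(sphereCard q k : ℂ) * v x‖ ≤ C := by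
    obtain ⟨C, hC⟩ := ((sphereFinset hG.isTree o k).image
      fun x => ‖(sphereCard q k : ℂ) * v x‖).bddAbove
    exact ⟨C, fun x hx => hC (Finset.mem_coe.2 (Finset.mem_image_of_mem _ hx))⟩
  have hfin : eLpNorm (massDensity G o q v k) r (boundaryMeasure G o) ≠ ∞ := by
    refine (MemLp.of_bound (stronglyMeasurable_eval' hG.isTree k fun x =>
      (sphereCard q k : ℂ) * v x).aestronglyMeasurable C
      (Filter.Eventually.of_forall fun ω => hC (ω k) ?_)).eLpNorm_ne_top
    exact (mem_sphereFinset hG.isTree).2 (ω.dist' k)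
  lift N to NNReal using hNtop
  lift eLpNorm (massDensity G o q v k) r (boundaryMeasure G o) to NNReal using hfin with m hm
  have key := lowerConst_mul_le hp1 hp2 hG.two_le ht ht2 (k := k) m.coe_nonneg N.coe_nonneg fun n hn => ?_
  · rw [← ENNReal.ofReal_coe_nnreal, ← ENNReal.ofReal_coe_nnreal (p := N),
      ← ENNReal.ofReal_mul (lowerConst_pos hp1 hp2).le]
    exact ENNReal.ofReal_le_ofReal key
  · have h1 := h.mul_eLpNorm_massDensity_le hG ht0 hv hr hn
    have h2 : ∀ n, ‖t ^ n‖ₑ * eLpNorm (fun ω : Boundary G o => u (ω n)) r (boundaryMeasure G o) ≤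
        ENNReal.ofReal ((1 + (‖t‖ ^ 2 - 1) / (q + 1) *
          ∑ j ∈ Finset.range n, (‖t‖ ^ 2 / q) ^ j) * N) := by
      intro n
      refine (mul_le_mul_right (hN n) _).trans (le_of_eq ?_)
      rw [← ofReal_norm, norm_pow, ← mul_assoc, ← ENNReal.ofReal_mul (by positivity),
        ENNReal.ofReal_mul' (NNReal.coe_nonneg N), ENNReal.ofReal_coe_nnreal, sphericalValue,
        mul_inv_cancel_left₀ (by positivity)]
    have hw : ∀ n, 0 ≤ (1 + (‖t‖ ^ 2 - 1) / (q + 1) *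
          ∑ j ∈ Finset.range n, (‖t‖ ^ 2 / q) ^ j) * (N : ℝ) := by
      intro n
      have h4 : 0 ≤ ‖t‖ ^ 2 - 1 := by nlinarith
      have h5 : 0 ≤ ∑ j ∈ Finset.range n, (‖t‖ ^ 2 / q) ^ j :=
        Finset.sum_nonneg fun j _ => by positivity
      positivity
    have h3 := h1.trans (add_le_add (h2 n) (h2 k))
    rw [← hm, ← ENNReal.ofReal_add (hw n) (hw k), ← ofReal_norm, ← ENNReal.ofReal_coe_nnreal,
      ← ENNReal.ofReal_mul (norm_nonneg _), ENNReal.ofReal_le_ofReal_iff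
        (add_nonneg (hw n) (hw k)), ← add_mul] at h3
    exact h3

end LocallyFinite

end HomTree

end

/-! ### Uniform integrability and passage to the boundary -/

noncomputable section

/-- A family which is bounded in `L^r` for some `r > 1` is uniformly integrable. -/
lemma MeasureTheory.unifIntegrable_one_of_eLpNorm_le {α β ι : Type*} {m : MeasurableSpace α}
    {μ : Measure α} [NormedAddCommGroup β] {f : ι → α → β} {r : ℝ≥0∞} (hr : 1 < r)
    (hf : ∀ i, AEStronglyMeasurable (f i) μ) {K : ℝ≥0∞} (hK : K ≠ ∞)
    (h : ∀ i, eLpNorm (f i) r μ ≤ K) : UnifIntegrable f 1 μ := by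
  intro ε hε
  -- The exponent in Hölder's inequality `‖f 1_s‖_1 ≤ ‖f‖_r μ(s)^a`. For `r = ∞` the convention
  -- `r.toReal = 0` gives `a = 1`, as it should.
  have ha : 0 < 1 - 1 / r.toReal := by
    rcases eq_or_ne r ∞ with rfl | hr'
    · simp
    · have h1 : 1 < r.toReal := by
        rwa [← ENNReal.toReal_one, ENNReal.toReal_lt_toReal ENNReal.one_ne_top hr']
      rw [sub_pos, div_lt_one (by linarith)]
      exact h1
  set a := 1 - 1 / r.toReal
  have hb : 0 < ε / (K.toReal + 1) := div_pos hε (by positivity)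
  -- The bound on the measure is chosen so that its power `a`, times `K + 1`, equals `ε`; adding one
  -- avoids division by zero.
  refine ⟨(ε / (K.toReal + 1)) ^ (1 / a), Real.rpow_pos_of_pos hb _, fun i s hs hμ => ?_⟩
  rw [eLpNorm_indicator_eq_eLpNorm_restrict hs]
  refine (eLpNorm_le_eLpNorm_mul_rpow_measure_univ hr.le (hf i).restrict).trans ?_
  rw [Measure.restrict_apply_univ, ENNReal.toReal_one, div_one]
  have h1 : eLpNorm (f i) r (μ.restrict s) ≤ ENNReal.ofReal (K.toReal + 1) := by
    refine (eLpNorm_restrict_le _ _ _ _).trans ((h i).trans ?_)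
    rw [← ENNReal.ofReal_toReal hK]
    refine ENNReal.ofReal_le_ofReal ?_
    rw [ENNReal.toReal_ofReal ENNReal.toReal_nonneg]
    linarith
  refine (mul_le_mul' h1 (ENNReal.rpow_le_rpow hμ ha.le)).trans (le_of_eq ?_)
  rw [ENNReal.ofReal_rpow_of_pos (Real.rpow_pos_of_pos hb _), ← Real.rpow_mul hb.le,
    one_div_mul_cancel ha.ne', Real.rpow_one, ← ENNReal.ofReal_mul (by positivity),
    mul_div_cancel₀ _ (by positivity)]

namespace HomTree

variable {V : Type u} {G : SimpleGraph V} {o : V}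

section LocallyFinite

variable [G.LocallyFinite] {q : ℕ}

/-! ### Recovering a function from its densities -/

/-- Lévy's upward theorem: the densities are conditional expectations along a filtration that
generates the whole `σ`-algebra. It is applied to real and imaginary parts. -/
lemma ae_tendsto_massDensity (hG : IsHomogeneousTree G q) {F : Boundary G o → ℂ}
    (hF : Integrable F (boundaryMeasure G o)) :
    ∀ᵐ ω ∂(boundaryMeasure G o), Filter.Tendsto (fun n => massDensity G o q
      (fun x => ∫ ω in sector G o x, F ω ∂(boundaryMeasure G o)) n ω) Filter.atTop (nhds (F ω)) := by
  have := isProbabilityMeasure_boundaryMeasure (o := o) hG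
  have key : ∀ L : ℂ →L[ℝ] ℝ, ∀ᵐ ω ∂(boundaryMeasure G o), Filter.Tendsto
      (fun n => L (massDensity G o q (fun x => ∫ ω in sector G o x, F ω ∂(boundaryMeasure G o)) n ω))
      Filter.atTop (nhds (L (F ω))) := by
    intro L
    have h1 := tendsto_ae_condExp (μ := boundaryMeasure G o) (ℱ := rayFiltration hG.isTree o)
      (L ∘ F)
    have h2 : (boundaryMeasure G o)[L ∘ F | ⨆ n, rayFiltration hG.isTree o n]
        =ᵐ[boundaryMeasure G o] L ∘ F := by
      refine condExp_of_aestronglyMeasurable' (iSup_le fun n => (rayFiltration hG.isTree o).le n) ?_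
        (L.integrable_comp hF)
      rw [iSup_rayFiltration]
      exact (L.integrable_comp hF).aestronglyMeasurable
    have h3 := ae_all_iff.2 fun n => massDensity_condExp hG hF n
    have h4 := ae_all_iff.2 fun n =>
      L.comp_condExp_comm (m := rayFiltration hG.isTree o n) hF
    filter_upwards [h1, h2, h3, h4] with ω h1 h2 h3 h4
    rw [h2] at h1
    refine h1.congr fun n => ?_
    rw [h3 n, ← h4 n]
    rfl
  filter_upwards [key Complex.reCLM, key Complex.imCLM] with ω h1 h2
  have h3 := (Complex.continuous_ofReal.tendsto _).comp h1
  have h4 := ((Complex.continuous_ofReal.tendsto _).comp h2).mul_const Complex.I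
  simpa [Function.comp_def, Complex.re_add_im] using h3.add h4

/-- Lower semicontinuity of the norm under almost everywhere convergence (Fatou). This also covers
`r = 1`. -/
lemma mul_eLpNorm_le_of_massDensity (hG : IsHomogeneousTree G q) {F : Boundary G o → ℂ}
    (hF : Integrable F (boundaryMeasure G o)) {r : ℝ≥0∞} {c : ℝ} (hc : 0 < c) {N : ℝ≥0∞}
    (h : ∀ n, ENNReal.ofReal c * eLpNorm (massDensity G o q
      (fun x => ∫ ω in sector G o x, F ω ∂(boundaryMeasure G o)) n) r (boundaryMeasure G o) ≤ N) :
    ENNReal.ofReal c * eLpNorm F r (boundaryMeasure G o) ≤ N := by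
  have hc0 : ENNReal.ofReal c ≠ 0 := (ENNReal.ofReal_pos.2 hc).ne'
  rw [mul_comm, ← ENNReal.le_div_iff_mul_le (Or.inl hc0) (Or.inl ENNReal.ofReal_ne_top)]
  refine Lp.eLpNorm_le_of_ae_tendsto (Filter.Eventually.of_forall fun n => ?_)
    (fun n => (stronglyMeasurable_eval' hG.isTree n fun x => (sphereCard q n : ℂ) *
      ∫ ω in sector G o x, F ω ∂(boundaryMeasure G o)).aestronglyMeasurable)
    (ae_tendsto_massDensity hG hF)
  rw [ENNReal.le_div_iff_mul_le (Or.inl hc0) (Or.inl ENNReal.ofReal_ne_top), mul_comm]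
  exact h n

/-- The bound in `L^r` with `r > 1` makes the martingale uniformly integrable, hence it is closed by
its limit, which inherits the bound. Integrating the closing relation over a sector recovers the
mass. -/
lemma exists_real_memLp_of_massDensity (hG : IsHomogeneousTree G q) {v : V → ℂ} (hv : IsFlow G o v)
    {r : ℝ≥0∞} (hr : 1 < r) {K : ℝ≥0∞} (hK : K ≠ ∞)
    (h : ∀ n, eLpNorm (massDensity G o q v n) r (boundaryMeasure G o) ≤ K) (L : ℂ →L[ℝ] ℝ) :
    ∃ g : Boundary G o → ℝ, MemLp g r (boundaryMeasure G o) ∧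
      ∀ x, ∫ ω in sector G o x, g ω ∂(boundaryMeasure G o) = L (v x) := by
  have := isProbabilityMeasure_boundaryMeasure (o := o) hG
  have hM := martingale_massDensity hG hv
  obtain ⟨f, hf⟩ : ∃ f : ℕ → Boundary G o → ℝ, ∀ n, f n = L ∘ massDensity G o q v n :=
    ⟨_, fun _ => rfl⟩
  have hmart : Martingale f (rayFiltration hG.isTree o) (boundaryMeasure G o) := by
    refine ⟨fun n => ?_, fun m n hmn => ?_⟩
    · rw [hf]
      exact L.continuous.comp_stronglyMeasurable (hM.stronglyMeasurable n)
    · rw [hf, hf]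
      filter_upwards [L.comp_condExp_comm (m := rayFiltration hG.isTree o m) (hM.integrable n),
        hM.2 m n hmn] with ω h1 h2
      rw [← h1, Function.comp_apply, h2]
      rfl
  have hmeas : ∀ n, AEStronglyMeasurable (f n) (boundaryMeasure G o) := fun n =>
    (hmart.integrable n).aestronglyMeasurable
  have hbdd : ∀ n, eLpNorm (f n) r (boundaryMeasure G o) ≤ ENNReal.ofReal ‖L‖ * K := by
    intro n
    refine (eLpNorm_le_mul_eLpNorm_of_ae_le_mul (g := massDensity G o q v n) (c := ‖L‖)
      (Filter.Eventually.of_forall fun ω => ?_) r).trans (mul_le_mul_right (h n) _)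
    rw [hf]
    exact L.le_opNorm _
  have hK' : ENNReal.ofReal ‖L‖ * K ≠ ∞ := ENNReal.mul_ne_top ENNReal.ofReal_ne_top hK
  have hR : ∀ n, eLpNorm (f n) r (boundaryMeasure G o) ≤ (ENNReal.ofReal ‖L‖ * K).toNNReal := by
    rwa [ENNReal.coe_toNNReal hK']
  have hunif : UniformIntegrable f 1 (boundaryMeasure G o) :=
    ⟨hmeas, unifIntegrable_one_of_eLpNorm_le hr hmeas hK' hbdd, _, fun n =>
      (eLpNorm_le_eLpNorm_of_exponent_le hr.le (hmeas n)).trans (hR n)⟩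
  have hg := hmart.submartingale.memLp_limitProcess hR
  refine ⟨_, hg, fun x => ?_⟩
  have h1 := hmart.ae_eq_condExp_limitProcess hunif (G.dist o x)
  have hx : MeasurableSet[rayFiltration hG.isTree o (G.dist o x)] (sector G o x) := by
    refine ⟨{x}, trivial, ?_⟩
    ext ω
    rw [mem_sector hG.isTree.connected]
    rfl
  rw [← setIntegral_condExp ((rayFiltration hG.isTree o).le _) (hg.integrable hr.le) hx,
    ← setIntegral_congr_ae (measurableSet_sector x) (h1.mono fun ω h _ => h), hf]
  have h2 := setIntegral_sector_eval hG (rfl : G.dist o x = G.dist o x)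
    fun y => L ((sphereCard q (G.dist o x) : ℂ) * v y)
  refine h2.trans ?_
  have h3 : (sphereCard q (G.dist o x) : ℂ) * v x =
    (sphereCard q (G.dist o x) : ℝ) • v x := by rw [Complex.real_smul]; push_cast; rfl
  have h4 := (sphereCard_pos hG.two_le (G.dist o x)).ne'
  rw [h3, L.map_smul, smul_smul, inv_mul_cancel₀ (by exact_mod_cast h4), one_smul]

/-- A mass function whose densities are bounded in `L^r`, `r > 1`, comes from an `L^r` function. -/
lemma exists_memLp_of_massDensity (hG : IsHomogeneousTree G q) {v : V → ℂ} (hv : IsFlow G o v)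
    {r : ℝ≥0∞} (hr : 1 < r) {K : ℝ≥0∞} (hK : K ≠ ∞)
    (h : ∀ n, eLpNorm (massDensity G o q v n) r (boundaryMeasure G o) ≤ K) :
    ∃ F, MemLp F r (boundaryMeasure G o) ∧
      v = fun x => ∫ ω in sector G o x, F ω ∂(boundaryMeasure G o) := by
  have := isProbabilityMeasure_boundaryMeasure (o := o) hG
  obtain ⟨f, hf, hf'⟩ := exists_real_memLp_of_massDensity hG hv hr hK h Complex.reCLM
  obtain ⟨g, hg, hg'⟩ := exists_real_memLp_of_massDensity hG hv hr hK h Complex.imCLM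
  have hfi : Integrable (fun ω => (f ω : ℂ)) (boundaryMeasure G o) := (hf.integrable hr.le).ofReal
  have hgi : Integrable (fun ω => (g ω : ℂ)) (boundaryMeasure G o) := (hg.integrable hr.le).ofReal
  have hgm : MemLp (fun ω => (g ω : ℂ) * Complex.I) r (boundaryMeasure G o) :=
    hg.ofReal.mul_const Complex.I
  have hfm : MemLp (fun ω => (f ω : ℂ)) r (boundaryMeasure G o) := hf.ofReal
  refine ⟨fun ω => (f ω : ℂ) + (g ω : ℂ) * Complex.I, hfm.add hgm, ?_⟩
  funext x
  have h1 : ∫ ω in sector G o x, ((f ω : ℂ) + (g ω : ℂ) * Complex.I) ∂(boundaryMeasure G o) =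
      (((v x).re : ℝ) : ℂ) + ((v x).im : ℝ) * Complex.I := by
    rw [integral_add hfi.integrableOn (hgi.mul_const _).integrableOn, integral_mul_const,
      integral_complex_ofReal, integral_complex_ofReal, hf', hg', Complex.reCLM_apply,
      Complex.imCLM_apply]
  rw [h1, Complex.re_add_im]

end LocallyFinite

/-! ### The measure with given masses of the sectors -/

/-- Given a probability measure on the children of every vertex, the event that the random ray
passes through a given vertex is a finite cylinder; its probability is the product of the transition
probabilities along the geodesic from `o`. -/
lemma exists_cylinder_of_transition (hG : G.IsTree) {w : V → ℝ≥0∞}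
    {κ : ∀ v, Measure (Children G o v)} (hκ : ∀ v (c : Children G o v), w v * κ v {c} = w c.1)
    (n : ℕ) :
    ∀ x : V, G.dist o x = n → ∃ (S : Finset V) (t : ∀ v, Set (Children G o v)),
      (∀ v ∈ S, G.dist o v < n) ∧
      (∀ s : ∀ v, Children G o v, rayFun G o s n = x ↔ s ∈ Set.pi (S : Set V) t) ∧
      w o * ∏ v ∈ S, κ v (t v) = w x := by
  classical
  induction n with
  | zero =>
    intro x hx
    have hx' : o = x := hG.connected.dist_eq_zero_iff.1 hx
    exact ⟨∅, fun _ => Set.univ, by simp, fun s => by simp [rayFun, hx'], by simp [hx']⟩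
  | succ n ih =>
    intro x hx
    obtain ⟨y, hy, hyn⟩ := exists_parent hG hx
    obtain ⟨S, t, hS, hst, hprod⟩ := ih y hyn
    have hyS : y ∉ S := fun h => by have := hS y h; omega
    let c : Children G o y := ⟨x, hy, by omega⟩
    have hne : ∀ v ∈ S, v ≠ y := fun v hv h => hyS (h ▸ hv)
    refine ⟨insert y S, Function.update t y {c}, ?_, ?_, ?_⟩
    · intro v hv
      rcases Finset.mem_insert.1 hv with rfl | hv
      · omega
      · have := hS v hv; omega
    · intro s
      have h1 : rayFun G o s (n + 1) = x ↔ s y = c ∧ rayFun G o s n = y := by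
        constructor
        · intro h
          have h2 : (s (rayFun G o s n)).1 = x := h
          have h3 : rayFun G o s n = y := by
            have h4 := (s (rayFun G o s n)).2
            rw [h2] at h4
            exact parent_unique hG h4.1 hy h4.2 (by omega)
          rw [h3] at h2
          exact ⟨Subtype.ext h2, h3⟩
        · rintro ⟨h2, h3⟩
          change (s (rayFun G o s n)).1 = x
          rw [h3, h2]
      rw [h1, hst, Finset.coe_insert, Set.insert_pi]
      refine and_congr (by simp) ?_
      simp only [Set.mem_pi]
      refine forall₂_congr fun v hv => ?_
      rw [Function.update_of_ne (hne v hv)]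
    · have h5 : ∏ v ∈ S, κ v (Function.update t y {c} v) = ∏ v ∈ S, κ v (t v) :=
        Finset.prod_congr rfl fun v hv => by rw [Function.update_of_ne (hne v hv)]
      rw [Finset.prod_insert hyS, Function.update_self, h5, mul_left_comm, hprod, mul_comm, hκ y c]

section LocallyFinite

variable [G.LocallyFinite] {q : ℕ}

lemma sum_children [∀ x, Fintype (Children G o x)] {E : Type*} [AddCommMonoid E] (x : V)
    (f : V → E) : ∑ c : Children G o x, f c.1 = ∑ y ∈ childFinset G o x, f y :=
  (Finset.sum_subtype (childFinset G o x) (fun _ => mem_childFinset) f).symm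

/-- A finite nonnegative additive mass function on the sectors comes from a finite measure. -/
lemma exists_measure_of_isFlow (hG : IsHomogeneousTree G q) {w : V → ℝ≥0∞} (hw : IsFlow G o w)
    (hfin : ∀ x, w x ≠ ∞) :
    ∃ μ : Measure (Boundary G o), IsFiniteMeasure μ ∧ ∀ x, μ (sector G o x) = w x := by
  classical
  have : ∀ x, Fintype (Children G o x) := fun x => Fintype.ofFinite _
  have hκ : ∀ v, ∃ κ : Measure (Children G o v), IsProbabilityMeasure κ ∧
      ∀ c : Children G o v, w v * κ {c} = w c.1 := by
    intro v
    rcases eq_or_ne (w v) 0 with h0 | h0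
    · obtain ⟨c⟩ := nonempty_children (o := o) hG v
      refine ⟨Measure.dirac c, inferInstance, fun c' => ?_⟩
      have h1 := hw v
      rw [h0, eq_comm, Finset.sum_eq_zero_iff] at h1
      rw [h0, zero_mul, h1 c'.1 (mem_childFinset.2 c'.2)]
    · refine ⟨∑ c : Children G o v, (w c.1 / w v) • Measure.dirac c, ⟨?_⟩, fun c => ?_⟩
      · simp only [Measure.finsetSum_apply, Measure.smul_apply, measure_univ, smul_eq_mul, mul_one]
        simp_rw [div_eq_mul_inv]
        rw [← Finset.sum_mul, sum_children v w, ← hw v, ENNReal.mul_inv_cancel h0 (hfin v)]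
      · rw [Measure.finsetSum_apply, Finset.sum_eq_single c]
        · simp only [Measure.smul_apply, smul_eq_mul]
          rw [Measure.dirac_apply_of_mem (Set.mem_singleton c), mul_one, ENNReal.mul_div_cancel h0 (hfin v)]
        · intro c' _ hc'
          simp [hc']
        · simp
  choose κ hprob hκ using hκ
  refine ⟨w o • (Measure.infinitePi κ).map (ray G o), ⟨?_⟩, fun x => ?_⟩
  · rw [Measure.smul_apply, Measure.map_apply (measurable_ray hG) MeasurableSet.univ,
      Set.preimage_univ, measure_univ, smul_eq_mul, mul_one]
    exact (hfin o).lt_top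
  · obtain ⟨S, t, -, hst, hprod⟩ := exists_cylinder_of_transition hG.isTree hκ _ x rfl
    have h : ray G o ⁻¹' sector G o x = Set.pi (S : Set V) t := by
      ext s
      rw [Set.mem_preimage, mem_sector hG.isTree.connected, ← hst]
      rfl
    rw [Measure.smul_apply, Measure.map_apply (measurable_ray hG) (measurableSet_sector x), h,
      Measure.infinitePi_pi (μ := κ) (fun _ _ => trivial), smul_eq_mul, hprod]

/-! ### Signed and complex masses of bounded variation -/

lemma sum_sphereFinset_succ (hG : G.IsTree) (n : ℕ) {E : Type*} [AddCommMonoid E] (f : V → E) :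
    ∑ x ∈ sphereFinset hG o n, ∑ y ∈ childFinset G o x, f y =
      ∑ y ∈ sphereFinset hG o (n + 1), f y := by
  classical
  rw [← Finset.sum_biUnion]
  · refine Finset.sum_congr ?_ fun _ _ => rfl
    ext y
    simp only [Finset.mem_biUnion, mem_sphereFinset, mem_childFinset]
    constructor
    · rintro ⟨x, hx, -, h⟩
      rw [h, hx]
    · intro hy
      obtain ⟨x, hx, hxn⟩ := exists_parent hG hy
      exact ⟨x, hxn, hx, by rw [hy, hxn]⟩
  · intro x _ y _ hxy
    refine Finset.disjoint_left.2 fun z hx hy => hxy ?_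
    rw [mem_childFinset] at hx hy
    exact parent_unique (o := o) hG hx.1 hy.1 hx.2 hy.2

/-- The least nonnegative additive mass function above an additive function of bounded variation. -/
lemma exists_isFlow_ge (hG : IsHomogeneousTree G q) {v : V → ℝ} (hv : IsFlow G o v)
    {K : ℝ≥0∞} (hK : K ≠ ∞) (h : ∀ n, ∑ x ∈ sphereFinset hG.isTree o n, ‖v x‖ₑ ≤ K) :
    ∃ w : V → ℝ≥0∞, IsFlow G o w ∧ (∀ x, w x ≠ ∞) ∧ ∀ x, ENNReal.ofReal (v x) ≤ w x := by
  set S : (V → ℝ≥0∞) → V → ℝ≥0∞ := fun f x => ∑ y ∈ childFinset G o x, f y with hS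
  set f : V → ℝ≥0∞ := fun x => ENNReal.ofReal (v x) with hf
  have hSmono : Monotone S := fun f g hfg x => Finset.sum_le_sum fun y _ => hfg y
  -- The positive part is subadditive, so passing to the children can only increase the sum.
  -- Iterating sums positive parts over the descendants `m` generations below, and the flow sought
  -- is the increasing limit.
  have hfS : f ≤ S f := by
    intro x
    simp only [hf, hS]
    rw [hv x]
    exact Finset.le_sum_of_subadditive _ ENNReal.ofReal_zero.le (fun a b => ENNReal.ofReal_add_le) _ _
  have hmono : Monotone fun m => S^[m] f := hSmono.monotone_iterate_of_le_map hfS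
  have hsum : ∀ m n, ∑ x ∈ sphereFinset hG.isTree o n, S^[m] f x =
      ∑ x ∈ sphereFinset hG.isTree o (n + m), f x := by
    intro m
    induction m with
    | zero => intro n; rfl
    | succ m ih =>
      intro n
      rw [Function.iterate_succ_apply', hS]
      simp only
      rw [sum_sphereFinset_succ hG.isTree n, ← hS, ih]
      congr 2
      omega
  refine ⟨fun x => ⨆ m, S^[m] f x, fun x => ?_, fun x => ?_, fun x => ?_⟩
  · simp only
    rw [ENNReal.finsetSum_iSup_of_monotone fun y => fun m n hmn => hmono hmn y]
    refine le_antisymm (iSup_le fun m => ?_) (iSup_le fun m => ?_)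
    · refine le_trans (hmono (Nat.le_succ m) x) ?_
      simp only
      rw [Function.iterate_succ_apply']
      exact le_iSup (fun m => ∑ y ∈ childFinset G o x, S^[m] f y) m
    · refine le_trans (le_of_eq ?_) (le_iSup _ (m + 1))
      rw [Function.iterate_succ_apply']
  · refine ne_top_of_le_ne_top hK (iSup_le fun m => ?_)
    -- One value is at most the sum over its sphere, which equals a sum of positive parts over a
    -- larger sphere and is thus bounded by `K`.
    refine (Finset.single_le_sum (f := S^[m] f) (fun _ _ => zero_le)
      ((mem_sphereFinset hG.isTree).2 (rfl : G.dist o x = _))).trans ?_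
    rw [hsum]
    refine (Finset.sum_le_sum fun y _ => ?_).trans (h _)
    simp only [hf]
    rw [← ofReal_norm]
    exact ENNReal.ofReal_le_ofReal (le_abs_self _)
  · exact le_iSup (fun m => S^[m] f x) 0

/-- With `w` a finite additive majorant of `v`, both `w` and `w - v` are nonnegative and additive,
and `v` is their difference. -/
lemma exists_signedMeasure_of_isFlow (hG : IsHomogeneousTree G q) {v : V → ℝ} (hv : IsFlow G o v)
    {K : ℝ≥0∞} (hK : K ≠ ∞) (h : ∀ n, ∑ x ∈ sphereFinset hG.isTree o n, ‖v x‖ₑ ≤ K) :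
    ∃ μ : SignedMeasure (Boundary G o), ∀ x, μ (sector G o x) = v x := by
  obtain ⟨w, hw, hfin, hvw⟩ := exists_isFlow_ge hG hv hK h
  have hle : ∀ x, v x ≤ (w x).toReal := fun x =>
    (ENNReal.ofReal_le_iff_le_toReal (hfin x)).1 (hvw x)
  obtain ⟨μ, hμ, hμw⟩ := exists_measure_of_isFlow hG hw hfin
  obtain ⟨μ', hμ', hμw'⟩ := exists_measure_of_isFlow (w := fun x => ENNReal.ofReal
    ((w x).toReal - v x)) hG (fun x => by
      rw [← ENNReal.ofReal_sum_of_nonneg fun y _ => sub_nonneg.2 (hle y), Finset.sum_sub_distrib,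
        ← hv x, ← ENNReal.toReal_sum fun y _ => hfin y, ← hw x]) fun x => ENNReal.ofReal_ne_top
  refine ⟨μ.toSignedMeasure - μ'.toSignedMeasure, fun x => ?_⟩
  rw [sub_apply, Measure.toSignedMeasure_apply_measurable (measurableSet_sector x),
    Measure.toSignedMeasure_apply_measurable (measurableSet_sector x), measureReal_def,
    measureReal_def, hμw, hμw', ENNReal.toReal_ofReal (sub_nonneg.2 (hle x)), sub_sub_cancel]

lemma eLpNorm_one_massDensity (hG : IsHomogeneousTree G q) (v : V → ℂ) (n : ℕ) :
    eLpNorm (massDensity G o q v n) 1 (boundaryMeasure G o) =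
      ∑ x ∈ sphereFinset hG.isTree o n, ‖v x‖ₑ := by
  have h0 : (sphereCard q n : ℝ≥0∞) ≠ 0 := by exact_mod_cast (sphereCard_pos hG.two_le n).ne'
  rw [eLpNorm_one_eq_lintegral_enorm]
  have := lintegral_eval (o := o) hG n fun x : V => ‖(sphereCard q n : ℂ) * v x‖ₑ
  refine this.trans ?_
  simp_rw [enorm_mul]
  have h1 : ‖(sphereCard q n : ℂ)‖ₑ = sphereCard q n := by
    rw [← ofReal_norm, Complex.norm_natCast, ENNReal.ofReal_natCast]
  rw [← Finset.mul_sum, h1, mul_div_assoc, ENNReal.mul_div_cancel h0 (ENNReal.natCast_ne_top _)]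

/-- A mass function whose densities are bounded in `L^1` comes from a complex measure. -/
lemma exists_complexMeasure_of_massDensity (hG : IsHomogeneousTree G q) {v : V → ℂ}
    (hv : IsFlow G o v) {K : ℝ≥0∞} (hK : K ≠ ∞)
    (h : ∀ n, eLpNorm (massDensity G o q v n) 1 (boundaryMeasure G o) ≤ K) :
    ∃ μ : ComplexMeasure (Boundary G o), v = fun x => μ (sector G o x) := by
  simp_rw [eLpNorm_one_massDensity hG] at h
  obtain ⟨μ, hμ⟩ := exists_signedMeasure_of_isFlow hG (v := fun x => (v x).re)
    (fun x => by simp only; rw [hv x, Complex.re_sum]) hK fun n =>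
    (Finset.sum_le_sum fun x _ => enorm_le_iff_norm_le.2 (Complex.abs_re_le_norm (v x))).trans (h n)
  obtain ⟨μ', hμ'⟩ := exists_signedMeasure_of_isFlow hG (v := fun x => (v x).im)
    (fun x => by simp only; rw [hv x, Complex.im_sum]) hK fun n =>
    (Finset.sum_le_sum fun x _ => enorm_le_iff_norm_le.2 (Complex.abs_im_le_norm (v x))).trans (h n)
  refine ⟨μ.toComplexMeasure μ', funext fun x => ?_⟩
  rw [SignedMeasure.toComplexMeasure_apply, hμ, hμ']

/-- The sectors of one sphere are disjoint, so the absolute values of their masses add up to at most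
the total variation. -/
lemma eLpNorm_massDensity_complexMeasure_le (hG : IsHomogeneousTree G q)
    (μ : ComplexMeasure (Boundary G o)) (n : ℕ) :
    eLpNorm (massDensity G o q (fun x => μ (sector G o x)) n) 1 (boundaryMeasure G o) ≤
      μ.variation Set.univ := by
  rw [eLpNorm_one_massDensity hG]
  refine (Finset.sum_le_sum fun x _ => μ.enorm_measure_le_variation _).trans ?_
  rw [← measure_biUnion_finset ?_ fun x _ => measurableSet_sector x]
  · exact measure_mono (Set.subset_univ _)
  · intro x hx y hy hxy
    have hx' := (mem_sphereFinset hG.isTree).1 (Finset.mem_coe.1 hx)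
    have hy' := (mem_sphereFinset hG.isTree).1 (Finset.mem_coe.1 hy)
    exact disjoint_sector hG.isTree (hx'.trans hy'.symm) hxy

end LocallyFinite

/-! ### The parameter at exponent two -/

lemma poissonBase_sq_of_tau {q : ℕ} (hq : 2 ≤ q) {α : ℝ} {k : ℤ} (hα : α = tau q / 2 * k) :
    poissonBase q α ^ 2 = q := by
  have hq0 : (q : ℂ) ≠ 0 := by exact_mod_cast (by omega : q ≠ 0)
  have hlog : Real.log q ≠ 0 := (Real.log_pos (by exact_mod_cast hq)).ne'
  have hlog' : (Real.log q : ℂ) ≠ 0 := by exact_mod_cast hlog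
  have h1 : Complex.log q = (Real.log q : ℂ) := Complex.natCast_log.symm
  rw [poissonBase, ← Complex.cpow_nat_mul, show ((2 : ℕ) : ℂ) * (1 / 2 + Complex.I * α) =
    1 + 2 * Complex.I * α by push_cast; ring, Complex.cpow_add _ _ hq0, Complex.cpow_one,
    Complex.cpow_def_of_ne_zero hq0, h1]
  have hlog'' : Complex.log q ≠ 0 := by rwa [h1]
  -- The exponent `2iα log q` is an integer multiple of `2πi`, so `q^(2iα) = 1`.
  have h2 : (Real.log q : ℂ) * (2 * Complex.I * α) = k * (2 * Real.pi * Complex.I) := by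
    rw [hα, tau]
    push_cast
    field_simp
  rw [h2, Complex.exp_int_mul_two_pi_mul_I, mul_one]

/-! ### Hardy norms versus bounds on densities -/

section LocallyFinite

variable [G.LocallyFinite] {q : ℕ}

/-- An eigenfunction with finite Hardy norm is the transform of a mass function whose densities are
bounded in `L^r`. -/
lemma exists_massDensity_le_of_hardyNorm (hG : IsHomogeneousTree G q) (ω₀ : Boundary G o) {p : ℝ}
    (hp1 : 1 ≤ p) (hp2 : p ≤ 2) {z : ℂ} (ht : ‖poissonBase q z‖ = (q : ℝ) ^ (1 / p))
    (ht2 : p = 2 → poissonBase q z ^ 2 = q) {r : ℝ≥0∞} (hr : 1 ≤ r) {u : V → ℂ}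
    (hu : hardyNorm G q o ω₀ p r u < ∞)
    (hL : laplacian G q u = fun x => gammaEigenvalue q z * u x) :
    ∃ v, HasMass G o (poissonBase q z) v u ∧ IsFlow G o v ∧ ∃ K : ℝ≥0∞, K ≠ ∞ ∧
      ∀ n, eLpNorm (massDensity G o q v n) r (boundaryMeasure G o) ≤ K := by
  have hq2 : (2 : ℝ) ≤ q := by exact_mod_cast hG.two_le
  have hT1 : 1 < ‖poissonBase q z‖ := by
    rw [ht]; exact Real.one_lt_rpow (by linarith) (by positivity)
  have ht0 := poissonBase_ne_zero hG.two_le z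
  have ht1 : poissonBase q z ^ 2 ≠ 1 := fun h => by
    have := congrArg norm h
    rw [norm_pow, norm_one] at this
    nlinarith
  have hδ := poissonBase_delta hG.two_le p
  rw [← ht] at hδ
  obtain ⟨v, hv⟩ := exists_hasMass hG o ht0 ht1 u
  have hflow := (hv.isFlow_iff hG ht0 ht1).2 ((laplacian_eq_iff hG.two_le z u).1 hL)
  have h1 := (hardyNorm_le_iff hG ω₀ hT1.le hδ (zero_lt_one.trans_le hr).ne' u).1 le_rfl
  have h2 := hv.eLpNorm_massDensity_le hG hp1 hp2 ht ht2 hflow hr h1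
  have hc0 : ENNReal.ofReal (lowerConst p) ≠ 0 :=
    (ENNReal.ofReal_pos.2 (lowerConst_pos hp1 hp2)).ne'
  refine ⟨v, hv, hflow, hardyNorm G q o ω₀ p r u / ENNReal.ofReal (lowerConst p),
    (ENNReal.div_lt_top hu.ne hc0).ne, fun n => ?_⟩
  rw [ENNReal.le_div_iff_mul_le (Or.inl hc0) (Or.inl ENNReal.ofReal_ne_top), mul_comm]
  exact h2 n

/-- Only finiteness is claimed, so Minkowski's inequality with the complex parameter suffices; this
avoids estimating an integral against a complex measure. -/
lemma hardyNorm_lt_top_of_massDensity (hG : IsHomogeneousTree G q) (ω₀ : Boundary G o) {p : ℝ}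
    (hp1 : 1 ≤ p) {z : ℂ} (ht : ‖poissonBase q z‖ = (q : ℝ) ^ (1 / p))
    {r : ℝ≥0∞} (hr : 1 ≤ r) {v u : V → ℂ} (h : HasMass G o (poissonBase q z) v u) {K : ℝ≥0∞}
    (hK : K ≠ ∞) (hv : ∀ n, eLpNorm (massDensity G o q v n) r (boundaryMeasure G o) ≤ K) :
    hardyNorm G q o ω₀ p r u < ∞ := by
  have hq2 : (2 : ℝ) ≤ q := by exact_mod_cast hG.two_le
  have hT1 : 1 < ‖poissonBase q z‖ := by
    rw [ht]; exact Real.one_lt_rpow (by linarith) (by positivity)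
  have hδ := poissonBase_delta hG.two_le p
  rw [← ht] at hδ
  set t := poissonBase q z
  have hT2 : 0 < ‖t‖ ^ 2 - 1 := by nlinarith
  -- `D` compares `‖t² - 1‖ ≤ ‖t‖² + 1` with the factor `‖t‖² - 1` in the spherical function.
  set D := (‖t‖ ^ 2 + 1) / (‖t‖ ^ 2 - 1) with hD
  have hD1 : 1 ≤ D := by rw [hD, one_le_div hT2]; linarith
  refine lt_of_le_of_lt ((hardyNorm_le_iff hG ω₀ hT1.le hδ (zero_lt_one.trans_le hr).ne' u
    (N := ENNReal.ofReal D * K)).2 fun n => ?_)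
    (ENNReal.mul_lt_top ENNReal.ofReal_lt_top hK.lt_top)
  refine (h.eLpNorm_le hG hr hv n).trans ?_
  rw [← mul_assoc, ← ENNReal.ofReal_mul (sphericalValue_pos hT1.le n).le]
  refine mul_le_mul_left (ENNReal.ofReal_le_ofReal ?_) K
  rw [sphericalValue, mul_assoc]
  gcongr
  have hS : 0 ≤ ∑ j ∈ Finset.range n, (‖t‖ ^ 2 / q) ^ j :=
    Finset.sum_nonneg fun j _ => by positivity
  have h1 : ‖t ^ 2 - 1‖ ≤ (‖t‖ ^ 2 - 1) * D := by
    rw [hD, mul_div_cancel₀ _ hT2.ne']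
    have := norm_sub_le (t ^ 2) 1
    rwa [norm_pow, norm_one] at this
  rw [add_mul, one_mul]
  refine add_le_add hD1 ?_
  calc ‖t ^ 2 - 1‖ / (q + 1) * ∑ j ∈ Finset.range n, (‖t‖ ^ 2 / q) ^ j
      ≤ ((‖t‖ ^ 2 - 1) * D) / (q + 1) * ∑ j ∈ Finset.range n, (‖t‖ ^ 2 / q) ^ j := by gcongr
    _ = _ := by ring

end LocallyFinite

end HomTree

end

/-! ### The characterisation of Poisson transforms -/

open HomTree in
theorem mainTheorem1 (p : ℝ) (hp1 : 1 ≤ p) (hp2 : p ≤ 2) :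
    ∃ C : ℝ, 0 < C ∧
      ∀ (V : Type u) (G : SimpleGraph V) [G.LocallyFinite] (q : ℕ)
        (_ : HomTree.IsHomogeneousTree G q) (o : V) (ω₀ : HomTree.Boundary G o)
        (α : ℝ) (_ : p = 2 → ∃ k : ℤ, α = HomTree.tau q / 2 * k)
        (z : ℂ) (_ : z = (α : ℂ) + Complex.I * ((-HomTree.delta p : ℝ) : ℂ)),
        (∀ r : ℝ≥0∞, 1 < r → ∀ u : V → ℂ,
          (∃ F : HomTree.Boundary G o → ℂ, MemLp F r (HomTree.boundaryMeasure G o) ∧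
              u = HomTree.poissonTransform G q o z F) ↔
            (HomTree.hardyNorm G q o ω₀ p r u < ∞ ∧
              HomTree.laplacian G q u = fun x => HomTree.gammaEigenvalue q z * u x)) ∧
        (∀ u : V → ℂ,
          (∃ μ : ComplexMeasure (HomTree.Boundary G o),
              u = HomTree.poissonTransformMeasure G q o z μ) ↔
            (HomTree.hardyNorm G q o ω₀ p 1 u < ∞ ∧
              HomTree.laplacian G q u = fun x => HomTree.gammaEigenvalue q z * u x)) ∧
        (∀ r : ℝ≥0∞, 1 ≤ r → ∀ F : HomTree.Boundary G o → ℂ,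
          MemLp F r (HomTree.boundaryMeasure G o) →
            ENNReal.ofReal C * eLpNorm F r (HomTree.boundaryMeasure G o) ≤
                HomTree.hardyNorm G q o ω₀ p r (HomTree.poissonTransform G q o z F) ∧
              HomTree.hardyNorm G q o ω₀ p r (HomTree.poissonTransform G q o z F) ≤
                eLpNorm F r (HomTree.boundaryMeasure G o)) := by
  refine ⟨lowerConst p, lowerConst_pos hp1 hp2, ?_⟩
  intro V G _ q hG o ω₀ α hα z hz
  have hprob := isProbabilityMeasure_boundaryMeasure (o := o) hG
  have hq2 : (2 : ℝ) ≤ q := by exact_mod_cast hG.two_le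
  have ht : ‖poissonBase q z‖ = (q : ℝ) ^ (1 / p) := by
    -- The imaginary part is `-δ_p`, so the modulus of the base is `q` to the power `1/2 + δ_p =
    -- 1/p`.
    have him : z.im = 1 / 2 - 1 / p := by rw [hz]; simp [delta]
    rw [norm_poissonBase hG.two_le, him, sub_sub_cancel]
  have ht2 : p = 2 → poissonBase q z ^ 2 = q := by
    intro hp
    obtain ⟨k, hk⟩ := hα hp
    have : z = α := by rw [hz, hp]; simp [delta]
    rw [this, poissonBase_sq_of_tau hG.two_le hk]
  have hT1 : 1 < ‖poissonBase q z‖ := by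
    rw [ht]; exact Real.one_lt_rpow (by linarith) (by positivity)
  have ht0 := poissonBase_ne_zero hG.two_le z
  have ht1 : poissonBase q z ^ 2 ≠ 1 := fun h => by
    have := congrArg norm h
    rw [norm_pow, norm_one] at this
    nlinarith
  have hδ := poissonBase_delta hG.two_le p
  rw [← ht] at hδ
  have heig : ∀ {v u : V → ℂ}, HasMass G o (poissonBase q z) v u → IsFlow G o v →
      laplacian G q u = fun x => gammaEigenvalue q z * u x := fun h hv =>
    (laplacian_eq_iff hG.two_le z _).2 ((h.isFlow_iff hG ht0 ht1).1 hv)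
  have upper : ∀ r : ℝ≥0∞, 1 ≤ r → ∀ F : Boundary G o → ℂ, MemLp F r (boundaryMeasure G o) →
      hardyNorm G q o ω₀ p r (poissonTransform G q o z F) ≤ eLpNorm F r (boundaryMeasure G o) :=
    fun r hr F hF => (hardyNorm_le_iff hG ω₀ hT1.le hδ (zero_lt_one.trans_le hr).ne' _).2
      (eLpNorm_poissonTransform_le hG z rfl hT1.le hr (hF.integrable hr))
  refine ⟨fun r hr u => ⟨?_, ?_⟩, fun u => ⟨?_, ?_⟩, fun r hr F hF => ⟨?_, upper r hr F hF⟩⟩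
  · rintro ⟨F, hF, rfl⟩
    have hFi := hF.integrable hr.le
    exact ⟨(upper r hr.le F hF).trans_lt hF.2,
      heig (hasMass_poissonTransform hG z hFi) (isFlow_setIntegral hG.isTree hFi)⟩
  · rintro ⟨hu, hL⟩
    obtain ⟨v, hv, hflow, K, hK, hvK⟩ :=
      exists_massDensity_le_of_hardyNorm hG ω₀ hp1 hp2 ht ht2 hr.le hu hL
    obtain ⟨F, hF, rfl⟩ := exists_memLp_of_massDensity hG hflow hr hK hvK
    exact ⟨F, hF, hv.unique hG (hasMass_poissonTransform hG z (hF.integrable hr.le))⟩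
  · rintro ⟨μ, rfl⟩
    have hμ := isFiniteMeasure_variation μ
    have hm := hasMass_poissonTransformMeasure hG z μ
    exact ⟨hardyNorm_lt_top_of_massDensity hG ω₀ hp1 ht le_rfl hm (measure_ne_top _ _)
      (eLpNorm_massDensity_complexMeasure_le hG μ), heig hm (isFlow_vectorMeasure hG.isTree μ)⟩
  · rintro ⟨hu, hL⟩
    obtain ⟨v, hv, hflow, K, hK, hvK⟩ :=
      exists_massDensity_le_of_hardyNorm hG ω₀ hp1 hp2 ht ht2 le_rfl hu hL
    obtain ⟨μ, rfl⟩ := exists_complexMeasure_of_massDensity hG hflow hK hvK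
    exact ⟨μ, hv.unique hG (hasMass_poissonTransformMeasure hG z μ)⟩
  · have hFi := hF.integrable hr
    refine mul_eLpNorm_le_of_massDensity hG hFi (lowerConst_pos hp1 hp2) fun n => ?_
    exact (hasMass_poissonTransform hG z hFi).eLpNorm_massDensity_le hG hp1 hp2 ht ht2
      (isFlow_setIntegral hG.isTree hFi) hr
      ((hardyNorm_le_iff hG ω₀ hT1.le hδ (zero_lt_one.trans_le hr).ne' _).1 le_rfl) n
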